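/- Let $b\ge 1$. A bucket increasing tree of size $n\ge 1$ with maximal bucket size $b$ is a rooted tree whose nodes (buckets) contain between $1$ and $b$ of the labels $1,\dots,n$, each label lying in exactly one node, such that every non-leaf contains exactly $b$ labels and the labels increase along every path starting at the root. Such trees are considered both as unordered trees and as ordered trees (the left-to-right order of the children of each node matters). For a node $v$ let $c(v)$ be its number of labels (capacity), $\deg^+(v)$ its out-degree. For non-negative sequences $(\varphi_k)_{k\ge0}$, $\varphi_0>0$, and $\psi_1,\dots,\psi_{b-1}$, the weight of a tree $T$ is $w(T)=\prod_{v:\,c(v)=b}\varphi_{\deg^+(v)}\prod_{v:\,c(v)<b}\psi_{c(v)}$; $T_n$ is the sum of $w(T)$ over all ordered bucket increasing trees of size $n$, and $T(z)=\sum_{n\ge1}T_nz^n/n!$. The random tree model is given by $\mathbb P^{[\mathcal T]}\{T\}=w(T)/T_n$ for ordered trees and $\mathbb P^{[\mathcal T]}\{T\}=w(T)\prod_v\deg^+(v)!/T_n$ for unordered trees of size $n$. In a tree evolution process one starts with a single node containing label $1$; given the tree of size $n$, label $n+1$ is attracted by node $v$ with probability $p(v)$, and is then added to $v$ if $c(v)<b$,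 and otherwise becomes the only label of a new child of $v$. The growth rules are - bucket recursive trees: $p(v)=\frac{c(v)}{n}$; - $(b,d)$-ary increasing trees ($d\ge2$ an integer): $p(v)=\frac{(d-1)c(v)+1-\deg^+(v)}{(d-1)n+1}$; - $(b,\alpha)$-plane oriented recursive trees ($\alpha>0$ real): $p(v)=\frac{\deg^+(v)+(\alpha+1)c(v)-1}{(\alpha+1)n-1}$. Let $\mathbb P^{[e]}\{T\}=\prod_{j=2}^n\pi^{(j)}(T)$ for unordered trees $T$ of size $n$, where $\pi^{(j)}(T)$ is the value $p(\mathrm{attr}(j))$ in the restriction $T_{<j}$ of $T$ to the labels less than $j$, and $\mathrm{attr}(j)$ is the node that attracted $j$; for ordered trees, $\mathbb P^{[e]}\{T\}=\prod_{j=2}^n\pi^{(j)}(T)/(\deg^+_{<j}(\mathrm{attr}(j))+1)$, where $\deg^+_{<j}$ is the out-degree in $T_{<j}$. **Theorem.** Each of the three processes is realized by the weights below; that is, the weights are non-negative with $\varphi_0>0$, and: (a) for every ordered bucket increasing tree $T$ of size $n\ge1$ with $w(T)\neq0$ and every node $v$ of $T$, the conditional probability under $\mathbb P^{[\mathcal T]}$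 for size $n+1$ that label $n+1$ is attracted by $v$, given that the restriction of the random tree to the labels $1,\dots,n$ is $T$, equals $p(v)$; (b) consequently $\mathbb P^{[e]}\{T\}=\mathbb P^{[\mathcal T]}\{T\}$ for all unordered and for all ordered bucket increasing trees $T$ of size $n\ge1$. 1. Bucket recursive trees: $\varphi_k=\frac{(b-1)!\,b^k}{k!}$ for $k\ge0$ and $\psi_k=(k-1)!$ for $1\le k\le b-1$, so that $\sum_k\varphi_kt^k=(b-1)!\,e^{bt}$ for all $t\in\mathbb C$. Then $T(z)=\log\frac1{1-z}$ for $|z|<1$ and $T_n=(n-1)!$ for $n\ge1$. 2. $(b,d)$-ary increasing trees: $\varphi_k=(b-1)!(d-1)^{b-1}\binom{b-1+\frac1{d-1}}{b-1}\binom{b(d-1)+1}{k}$ for $k\ge0$ and $\psi_k=(k-1)!(d-1)^{k-1}\binom{k-1+\frac1{d-1}}{k-1}$ for $1\le k\le b-1$, so that $\sum_k\varphi_kt^k=(b-1)!(d-1)^{b-1}\binom{b-1+\frac1{d-1}}{b-1}(1+t)^{b(d-1)+1}$ for all $t\in\mathbb C$. Then $T(z)=(1-(d-1)z)^{-\frac1{d-1}}-1$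 for $|z|<\frac1{d-1}$ and $T_n=(n-1)!(d-1)^{n-1}\binom{n-1+\frac1{d-1}}{n-1}$ for $n\ge1$. 3. $(b,\alpha)$-plane oriented recursive trees: $\varphi_k=(b-1)!(\alpha+1)^{b-1}\binom{b-1-\frac1{\alpha+1}}{b-1}\binom{(\alpha+1)b-2+k}{k}$ for $k\ge0$ and $\psi_k=(k-1)!(\alpha+1)^{k-1}\binom{k-1-\frac1{\alpha+1}}{k-1}$ for $1\le k\le b-1$, so that $\sum_k\varphi_kt^k=(b-1)!(\alpha+1)^{b-1}\binom{b-1-\frac1{\alpha+1}}{b-1}(1-t)^{-((\alpha+1)b-1)}$ for $|t|<1$. Then $T(z)=1-(1-(\alpha+1)z)^{\frac1{\alpha+1}}$ for $|z|<\frac1{\alpha+1}$ and $T_n=(n-1)!(\alpha+1)^{n-1}\binom{n-1-\frac1{\alpha+1}}{n-1}$ for $n\ge1$. -/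

import Mathlib

open Finset

namespace BucketIncreasing

/-- An unordered bucket increasing tree with maximal bucket size `b` and with the labels
`1, …, size`. The nodes are buckets of labels; a node is named by the smallest label it contains,
so the root is the node `1`. `labels v` is the set of labels in node `v` and `children v` the set of
its children (both are empty if `v` is not the name of a node). For convenience the empty tree
(`size = 0`) is not excluded here; it is excluded by `1 ≤ size` where it matters. -/
@[ext]
structure UTree (b : ℕ) where
  /-- the number of labels -/
  size : ℕ
  /-- the labels contained in node `v` -/
  labels : ℕ → Finset ℕ
  /-- the children of node `v` -/
  children : ℕ → Finset ℕ
  labels_subset : ∀ v, labels v ⊆ Icc 1 size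
  existsUnique_labels : ∀ i ∈ Icc 1 size, ∃! v, i ∈ labels v
  name_eq_min : ∀ v, ∀ i ∈ labels v, v ∈ labels v ∧ v ≤ i
  card_labels_le : ∀ v, #(labels v) ≤ b
  children_nodes : ∀ v, ∀ w ∈ children v, v ∈ labels v ∧ w ∈ labels w
  existsUnique_parent : ∀ w, w ∈ labels w → w ≠ 1 → ∃! v, w ∈ children v
  saturated : ∀ v, (children v).Nonempty → #(labels v) = b
  increasing : ∀ v, ∀ w ∈ children v, ∀ x ∈ labels v, ∀ y ∈ labels w, x < y

namespace UTree

variable {b : ℕ}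

/-- The (names of the) nodes of the tree. -/
def nodes (T : UTree b) : Finset ℕ := (Icc 1 T.size).filter fun v => v ∈ T.labels v

/-- The capacity `c(v)`: the number of labels in node `v`. -/
def cap (T : UTree b) (v : ℕ) : ℕ := #(T.labels v)

/-- The out-degree of node `v`. -/
def outdeg (T : UTree b) (v : ℕ) : ℕ := #(T.children v)

/-- The restriction of the tree to the labels less than `j`. -/
def below (T : UTree b) (j : ℕ) : UTree b where
  size := min T.size (j - 1)
  labels v := (T.labels v).filter (· < j)
  children v := (T.children v).filter (· < j)
  labels_subset v i hi := by
    have h1 := T.labels_subset v (mem_filter.1 hi).1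
    have h2 := (mem_filter.1 hi).2
    simp only [mem_Icc] at h1 ⊢
    omega
  existsUnique_labels i hi := by
    simp only [mem_Icc] at hi
    obtain ⟨v, hv, hu⟩ := T.existsUnique_labels i (by simp only [mem_Icc]; omega)
    refine ⟨v, mem_filter.2 ⟨hv, by omega⟩, fun w hw => hu w (mem_filter.1 hw).1⟩
  name_eq_min v i hi := by
    obtain ⟨h1, h2⟩ := mem_filter.1 hi
    obtain ⟨h3, h4⟩ := T.name_eq_min v i h1
    exact ⟨mem_filter.2 ⟨h3, by omega⟩, h4⟩
  card_labels_le v := (card_filter_le _ _).trans (T.card_labels_le v)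
  children_nodes v w hw := by
    obtain ⟨h1, h2⟩ := mem_filter.1 hw
    obtain ⟨h3, h4⟩ := T.children_nodes v w h1
    have := T.increasing v w h1 v h3 w h4
    exact ⟨mem_filter.2 ⟨h3, by omega⟩, mem_filter.2 ⟨h4, h2⟩⟩
  existsUnique_parent w hw hw1 := by
    obtain ⟨h1, h2⟩ := mem_filter.1 hw
    obtain ⟨v, hv, hu⟩ := T.existsUnique_parent w h1 hw1
    exact ⟨v, mem_filter.2 ⟨hv, h2⟩, fun u h => hu u (mem_filter.1 h).1⟩
  saturated v hv := by
    obtain ⟨w, hw⟩ := hv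
    obtain ⟨h1, h2⟩ := mem_filter.1 hw
    rw [filter_true_of_mem, T.saturated v ⟨w, h1⟩]
    intro x hx
    exact (T.increasing v w h1 x hx w (T.children_nodes v w h1).2).trans h2
  increasing v w hw x hx y hy :=
    T.increasing v w (mem_filter.1 hw).1 x (mem_filter.1 hx).1 y (mem_filter.1 hy).1

/-- Node `v` attracted label `j`: either `j` is the first label of a child of `v`, or `j` was added
to the already existing node `v`. -/
def Attracts (T : UTree b) (v j : ℕ) : Prop :=
  j ∈ T.children v ∨ (v ≠ j ∧ j ∈ T.labels v)

/-- Every label except `1` was attracted by exactly one node. -/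
theorem existsUnique_attracts (T : UTree b) {j : ℕ} (hj : 2 ≤ j) (hjn : j ≤ T.size) :
    ∃! v, T.Attracts v j := by
  obtain ⟨u, hu, huu⟩ := T.existsUnique_labels j (by simp only [mem_Icc]; omega)
  by_cases huj : u = j
  · subst huj
    obtain ⟨v, hv, hvu⟩ := T.existsUnique_parent u hu (by omega)
    refine ⟨v, Or.inl hv, ?_⟩
    rintro w (hw | ⟨hne, hw⟩)
    · exact hvu w hw
    · exact absurd (huu w hw) hne
  · refine ⟨u, Or.inr ⟨huj, hu⟩, ?_⟩
    rintro w (hw | ⟨-, hw⟩)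
    · exact absurd (huu j (T.children_nodes w j hw).2).symm huj
    · exact huu w hw

/-- The node `attr(j)` that attracted label `j` (the set has exactly one element for
`2 ≤ j ≤ size`). -/
noncomputable def attr (T : UTree b) (j : ℕ) : ℕ := sInf {v | T.Attracts v j}

/-- The weight of a tree: a saturated node contributes `φ` of its out-degree, an unsaturated one
contributes `ψ` of its capacity. -/
noncomputable def weight (φ ψ : ℕ → ℝ) (T : UTree b) : ℝ :=
  ∏ v ∈ T.nodes, if T.cap v = b then φ (T.outdeg v) else ψ (T.cap v)

end UTree

/-- An ordered bucket increasing tree: a bucket increasing tree together with a left-to-right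
order of the children of each node. -/
@[ext]
structure OTree (b : ℕ) extends UTree b where
  /-- the children of node `v`, from left to right -/
  order : ℕ → List ℕ
  order_nodup : ∀ v, (order v).Nodup
  order_toFinset : ∀ v, (order v).toFinset = children v

namespace OTree

variable {b : ℕ}

/-- The restriction of an ordered tree to the labels less than `j`. -/
def below (T : OTree b) (j : ℕ) : OTree b where
  toUTree := T.toUTree.below j
  order v := (T.order v).filter (· < j)
  order_nodup v := (T.order_nodup v).filter _
  order_toFinset v := by
    ext w
    have h := Finset.ext_iff.1 (T.order_toFinset v) w
    simp only [List.mem_toFinset] at h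
    simp [UTree.below, h]

end OTree

/-- The ordering map, embedding unordered trees into ordered ones: the subtrees of each node are
sorted by their smallest label, which is the name of the root node of the subtree. -/
def UTree.sorted {b : ℕ} (T : UTree b) : OTree b where
  toUTree := T
  order v := (T.children v).sort (· ≤ ·)
  order_nodup _ := Finset.sort_nodup _ _
  order_toFinset _ := Finset.sort_toFinset _ _

theorem finite_size (b n : ℕ) : {T : OTree b | T.size = n}.Finite := by
  have key : ∀ T : OTree b, T.size = n →
      ∀ v, (∀ x ∈ T.order v, x < n + 1) ∧ T.labels v ⊆ range (n + 1) ∧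
        (v ∉ range (n + 1) → T.labels v = ∅ ∧ T.order v = []) := by
    intro T hT v
    have hl : ∀ u, T.labels u ⊆ range (n + 1) := fun u i hi => by
      have := T.labels_subset u hi
      simp only [mem_Icc] at this
      simp only [mem_range]; omega
    have hc : ∀ x ∈ T.order v, x ∈ T.children v := fun x hx => by
      rw [← T.order_toFinset v]; simpa using hx
    refine ⟨fun x hx => ?_, hl v, fun hv => ⟨?_, ?_⟩⟩
    · simpa using hl x (T.children_nodes v x (hc x hx)).2
    · refine eq_empty_of_forall_notMem fun i hi => hv (hl v (T.name_eq_min v i hi).1)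
    · refine List.eq_nil_iff_forall_not_mem.2 fun x hx => hv (hl v ?_)
      exact (T.children_nodes v x (hc x hx)).1
  have hfin : Finite ((Fin (n + 1) → Finset (Fin (n + 1))) ×
      (Fin (n + 1) → {l : List (Fin (n + 1)) // l.Nodup})) := inferInstance
  rw [Set.Finite.eq_1 {T : OTree b | T.size = n}]
  refine Finite.of_injective (β := (Fin (n + 1) → Finset (Fin (n + 1))) ×
    (Fin (n + 1) → {l : List (Fin (n + 1)) // l.Nodup})) (fun T => (fun v =>
      (univ : Finset (Fin (n + 1))).filter fun i => (i : ℕ) ∈ T.1.labels v, fun v =>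
      ⟨(T.1.order v).pmap (fun x hx => (⟨x, hx⟩ : Fin (n + 1))) (key T.1 T.2 v).1,
        (T.1.order_nodup v).pmap fun _ _ _ _ h => congrArg Fin.val h⟩)) ?_
  rintro ⟨S, hS⟩ ⟨T, hT⟩ h
  have hS' : S.size = n := hS
  have hT' : T.size = n := hT
  simp only [Prod.mk.injEq] at h
  obtain ⟨h1, h2⟩ := h
  have hlab : S.labels = T.labels := by
    funext v
    by_cases hv : v ∈ range (n + 1)
    · ext i
      by_cases hi : i ∈ range (n + 1)
      · have := Finset.ext_iff.1 (congrFun h1 ⟨v, mem_range.1 hv⟩) ⟨i, mem_range.1 hi⟩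
        simpa using this
      · exact ⟨fun h => absurd ((key S hS' v).2.1 h) hi, fun h => absurd ((key T hT' v).2.1 h) hi⟩
    · rw [((key S hS' v).2.2 hv).1, ((key T hT' v).2.2 hv).1]
  have hord : S.order = T.order := by
    funext v
    by_cases hv : v ∈ range (n + 1)
    · have := congrArg (fun l => l.1.map Fin.val) (congrFun h2 ⟨v, mem_range.1 hv⟩)
      simpa [List.map_pmap] using this
    · rw [((key S hS' v).2.2 hv).2, ((key T hT' v).2.2 hv).2]
  refine Subtype.ext (OTree.ext (hS'.trans hT'.symm) hlab ?_ hord)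
  funext v
  rw [← S.order_toFinset v, ← T.order_toFinset v, hord]

/-- The ordered bucket increasing trees of size `n`. -/
noncomputable def trees (b n : ℕ) : Finset (OTree b) := (finite_size b n).toFinset

theorem mem_trees {b n : ℕ} {T : OTree b} : T ∈ trees b n ↔ T.size = n := by simp [trees]

/-! ### The random tree model -/

/-- The total weight `T_n` of the ordered bucket increasing trees of size `n`. -/
noncomputable def total (b : ℕ) (φ ψ : ℕ → ℝ) (n : ℕ) : ℝ := ∑ T ∈ trees b n, T.weight φ ψ

/-- The probability of an ordered tree under the random tree model (for its size). -/
noncomputable def OTree.treeProb {b : ℕ} (φ ψ : ℕ → ℝ) (T : OTree b) : ℝ :=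
  T.weight φ ψ / total b φ ψ T.size

/-- The probability of an unordered tree under the random tree model (for its size). -/
noncomputable def UTree.treeProb {b : ℕ} (φ ψ : ℕ → ℝ) (T : UTree b) : ℝ :=
  T.sorted.weight φ ψ * (∏ v ∈ T.nodes, ((T.outdeg v).factorial : ℝ)) / total b φ ψ T.size

open Classical in
/-- The conditional probability, under the random tree model for size `|T| + 1`, that the label
`|T| + 1` is attracted by the node `v`, given that the restriction of the random tree to the smaller
labels is the ordered tree `T`. -/
noncomputable def OTree.attractionProb {b : ℕ} (φ ψ : ℕ → ℝ) (T : OTree b) (v : ℕ) : ℝ :=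
  (∑ T' ∈ (trees b (T.size + 1)).filter
      (fun T' => T'.below (T.size + 1) = T ∧ T'.Attracts v (T.size + 1)), T'.treeProb φ ψ) /
    ∑ T' ∈ (trees b (T.size + 1)).filter (fun T' => T'.below (T.size + 1) = T), T'.treeProb φ ψ

/-! ### The tree evolution processes -/

/-- A growth rule gives the probability that a node attracts the label `n + 1`, as a function of
the capacity of the node, its out-degree and the size `n` of the tree. -/
abbrev GrowthRule := ℕ → ℕ → ℕ → ℝ

/-- The growth rule of bucket recursive trees. -/
noncomputable def recursiveRule : GrowthRule := fun c _ n => (c : ℝ) / n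

/-- The growth rule of `(b,d)`-ary increasing trees. -/
noncomputable def aryRule (d : ℕ) : GrowthRule := fun c deg n =>
  (((d : ℝ) - 1) * c + 1 - deg) / (((d : ℝ) - 1) * n + 1)

/-- The growth rule of `(b,α)`-plane oriented recursive trees. -/
noncomputable def portRule (α : ℝ) : GrowthRule := fun c deg n =>
  ((deg : ℝ) + (α + 1) * c - 1) / ((α + 1) * n - 1)

/-- The probability `p(v)` that node `v` of the tree `T` attracts the next label. -/
def UTree.growth {b : ℕ} (p : GrowthRule) (T : UTree b) (v : ℕ) : ℝ :=
  p (T.cap v) (T.outdeg v) T.size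

/-- The probability that label `j` is attracted by the node `attr(j)` in the restriction of the tree
to the labels less than `j` (and zero if the tree has fewer than `j` labels). -/
noncomputable def UTree.stepProb {b : ℕ} (p : GrowthRule) (j : ℕ) (T : UTree b) : ℝ :=
  if j ≤ T.size then (T.below j).growth p (T.attr j) else 0

/-- The probability of an unordered tree under the tree evolution process. -/
noncomputable def UTree.evolProb {b : ℕ} (p : GrowthRule) (T : UTree b) : ℝ :=
  ∏ j ∈ Icc 2 T.size, T.stepProb p j

/-- The probability of an ordered tree under the tree evolution process, in which a new child of
a node `v` is put with equal chance at one of the possible places among the children of `v`, whose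
number is the out-degree of `v` plus one. (If `j` is added to the unsaturated node `attr(j)`, then
this node is a leaf and the denominator is `1`.) -/
noncomputable def OTree.evolProb {b : ℕ} (p : GrowthRule) (T : OTree b) : ℝ :=
  ∏ j ∈ Icc 2 T.size,
    T.toUTree.stepProb p j / (((T.toUTree.below j).outdeg (T.attr j) : ℝ) + 1)

/-- The tree evolution process with growth rule `p` is realized by the family of bucket increasing
trees with the degree-weights `φ` and the bucket-weights `ψ 1, …, ψ (b - 1)`. -/
structure Realizes (b : ℕ) (p : GrowthRule) (φ ψ : ℕ → ℝ) : Prop where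
  φ_nonneg : ∀ k, 0 ≤ φ k
  φ_zero_pos : 0 < φ 0
  ψ_nonneg : ∀ k, 1 ≤ k → k < b → 0 ≤ ψ k
  /-- in the random tree model, labels are attracted according to the growth rule -/
  attraction : ∀ T : OTree b, 1 ≤ T.size → T.weight φ ψ ≠ 0 → ∀ v ∈ T.nodes,
    T.attractionProb φ ψ v = T.growth p v
  /-- the two models of randomness coincide for unordered trees -/
  unordered : ∀ T : UTree b, 1 ≤ T.size → T.evolProb p = T.treeProb φ ψ
  /-- the two models of randomness coincide for ordered trees -/
  ordered : ∀ T : OTree b, 1 ≤ T.size → T.evolProb p = T.treeProb φ ψ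

/-! ### The weight sequences -/

/-- Degree-weights of bucket recursive trees. -/
noncomputable def recursiveφ (b k : ℕ) : ℝ :=
  ((b - 1).factorial : ℝ) * (b : ℝ) ^ k / (k.factorial : ℝ)

/-- Bucket-weights of bucket recursive trees. -/
def recursiveψ (k : ℕ) : ℝ := ((k - 1).factorial : ℝ)

/-- Degree-weights of `(b,d)`-ary increasing trees. -/
noncomputable def aryφ (d b k : ℕ) : ℝ :=
  ((b - 1).factorial : ℝ) * ((d : ℝ) - 1) ^ (b - 1) *
    Ring.choose ((b : ℝ) - 1 + 1 / ((d : ℝ) - 1)) (b - 1) * ((b * (d - 1) + 1).choose k : ℝ)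

/-- Bucket-weights of `(b,d)`-ary increasing trees. -/
noncomputable def aryψ (d k : ℕ) : ℝ :=
  ((k - 1).factorial : ℝ) * ((d : ℝ) - 1) ^ (k - 1) *
    Ring.choose ((k : ℝ) - 1 + 1 / ((d : ℝ) - 1)) (k - 1)

/-- Degree-weights of `(b,α)`-plane oriented recursive trees. -/
noncomputable def portφ (α : ℝ) (b k : ℕ) : ℝ :=
  ((b - 1).factorial : ℝ) * (α + 1) ^ (b - 1) *
    Ring.choose ((b : ℝ) - 1 - 1 / (α + 1)) (b - 1) * Ring.choose ((α + 1) * b - 2 + k) k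

/-- Bucket-weights of `(b,α)`-plane oriented recursive trees. -/
noncomputable def portψ (α : ℝ) (k : ℕ) : ℝ :=
  ((k - 1).factorial : ℝ) * (α + 1) ^ (k - 1) *
    Ring.choose ((k : ℝ) - 1 - 1 / (α + 1)) (k - 1)

/-- The power series `∑ φ_k t^k` converges to `s`. -/
def HasGF (φ : ℕ → ℝ) (t s : ℂ) : Prop := HasSum (fun k : ℕ => (φ k : ℂ) * t ^ k) s

/-- The exponential generating function `∑_{n ≥ 1} T_n z^n / n!` converges to `s`. -/
def HasEGF (T : ℕ → ℝ) (z s : ℂ) : Prop :=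
  HasSum (fun n : ℕ => (T (n + 1) : ℂ) * z ^ (n + 1) / ((n + 1).factorial : ℂ)) s

end BucketIncreasing

open BucketIncreasing

/-! All three growth rules have the form `p(v) = (A c(v) + B (1 - deg⁺ v)) / (A n + B)`, with `(A,
B)` equal to `(1, 0)`, `(d - 1, 1)` and `(α + 1, -1)`. The capacities sum to `n` and the out-degrees
to the number of nodes minus one, so the numerators sum to `A n + B` (`UTree.sum_affine`).

Put `P m = ∏_{1 ≤ j ≤ m} (A j + B)`. In each case the weights satisfy `ψ k = P (k - 1)`, `φ 0 = P (b
- 1)` and `(k + 1) φ (k + 1) = (A b + B (1 - k)) φ k`; this is `AffineWeights`. If node `v` of `S`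
attracts the next label, then each resulting tree has the weight of `S` times the numerator of
`p(v)`, divided by `deg⁺ v + 1` (`AffineWeights.weight_mul`), and there are exactly `deg⁺ v + 1`
such ordered trees (`OTree.card_extensions`). Hence the extensions of `S` at `v` have total weight
`w(S)` times that numerator, and all extensions of `S` together have weight `w(S) (A n + B)`.

The quotient of these two sums is `p(v)`. Summing over `S` gives `T_{n+1} = (A n + B) T_n`, so `T_n
= P (n - 1)`, and both probability identities follow by induction on the size. Written with binomial
coefficients, `P` gives the closed forms of `T_n`; the generating functions are exponential,
logarithmic and binomial series. -/

namespace BucketIncreasing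

/-! ### Attaching the largest label to an unordered tree, and removing it -/

namespace UTree

variable {b : ℕ}

theorem one_le_of_mem_labels (T : UTree b) {v i : ℕ} (h : i ∈ T.labels v) : 1 ≤ i :=
  (mem_Icc.1 (T.labels_subset v h)).1

theorem le_size_of_mem_labels (T : UTree b) {v i : ℕ} (h : i ∈ T.labels v) : i ≤ T.size :=
  (mem_Icc.1 (T.labels_subset v h)).2

theorem mem_nodes (T : UTree b) {v : ℕ} : v ∈ T.nodes ↔ v ∈ T.labels v := by
  simp only [nodes, mem_filter, and_iff_right_iff_imp]
  exact fun h => T.labels_subset v h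

theorem eq_of_mem_labels (T : UTree b) {u v i : ℕ} (hu : i ∈ T.labels u) (hv : i ∈ T.labels v) :
    u = v :=
  (T.existsUnique_labels i (T.labels_subset u hu)).unique hu hv

theorem succ_size_notMem_labels (T : UTree b) (v : ℕ) : T.size + 1 ∉ T.labels v := fun h => by
  have := T.le_size_of_mem_labels h
  omega

theorem mem_labels_self_of_mem_children (T : UTree b) {v w : ℕ} (h : w ∈ T.children v) :
    w ∈ T.labels w := (T.children_nodes v w h).2

theorem succ_size_notMem_children (T : UTree b) (v : ℕ) : T.size + 1 ∉ T.children v := fun h =>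
  T.succ_size_notMem_labels _ (T.mem_labels_self_of_mem_children h)

theorem labels_eq_empty (T : UTree b) {v : ℕ} (h : v ∉ T.labels v) : T.labels v = ∅ :=
  eq_empty_of_forall_notMem fun i hi => h (T.name_eq_min v i hi).1

theorem children_eq_empty (T : UTree b) {v : ℕ} (h : v ∉ T.labels v) : T.children v = ∅ :=
  eq_empty_of_forall_notMem fun w hw => h (T.children_nodes v w hw).1

/-- Add the label `size + 1` to the unsaturated node `v`. -/
def addLabel (T : UTree b) (v : ℕ) (hv : v ∈ T.labels v) (hc : #(T.labels v) < b) : UTree b where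
  size := T.size + 1
  labels u := if u = v then insert (T.size + 1) (T.labels v) else T.labels u
  children := T.children
  labels_subset u i hi := by
    rw [mem_Icc]
    split_ifs at hi with h
    · rcases mem_insert.1 hi with rfl | hi
      · omega
      · have := mem_Icc.1 (T.labels_subset v hi); omega
    · have := mem_Icc.1 (T.labels_subset u hi); omega
  existsUnique_labels i hi := by
    rw [mem_Icc] at hi
    by_cases h : i = T.size + 1
    · subst h
      refine ⟨v, by simp, fun u hu => ?_⟩
      by_contra huv
      simp only [huv, if_false] at hu
      exact T.succ_size_notMem_labels u hu
    · obtain ⟨w, hw, hu⟩ := T.existsUnique_labels i (mem_Icc.2 (by omega))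
      refine ⟨w, ?_, fun u hu' => hu u ?_⟩
      · dsimp only
        split_ifs with hwv
        · subst hwv; exact mem_insert_of_mem hw
        · exact hw
      · dsimp only at hu'
        split_ifs at hu' with huv
        · subst huv; exact (mem_insert.1 hu').resolve_left h
        · exact hu'
  name_eq_min u i hi := by
    split_ifs at hi ⊢ with h
    · subst h
      refine ⟨mem_insert_of_mem hv, ?_⟩
      rcases mem_insert.1 hi with rfl | hi
      · have := T.le_size_of_mem_labels hv; omega
      · exact (T.name_eq_min u i hi).2
    · exact T.name_eq_min u i hi
  card_labels_le u := by
    split_ifs with h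
    · exact (card_insert_le _ _).trans hc
    · exact T.card_labels_le u
  children_nodes u w hw := by
    obtain ⟨h1, h2⟩ := T.children_nodes u w hw
    constructor
    · split_ifs with h
      · subst h; exact mem_insert_of_mem h1
      · exact h1
    · split_ifs with h
      · subst h; exact mem_insert_of_mem h2
      · exact h2
  existsUnique_parent w hw hw1 := by
    refine T.existsUnique_parent w ?_ hw1
    split_ifs at hw with h
    · exact h ▸ hv
    · exact hw
  -- A node with a child is full, hence is not the node `v` that receives the label.
  saturated u hu := by
    rw [if_neg]
    · exact T.saturated u hu
    · rintro rfl
      exact hc.ne (T.saturated u hu)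
  increasing u w hw x hx y hy := by
    rw [if_neg] at hx
    · split_ifs at hy with h
      · rcases mem_insert.1 hy with rfl | hy
        · have := T.le_size_of_mem_labels hx; omega
        · exact T.increasing u w hw x hx y (h ▸ hy)
      · exact T.increasing u w hw x hx y hy
    · rintro rfl
      exact hc.ne (T.saturated u ⟨w, hw⟩)

/-- Add a new child with the only label `size + 1` to the saturated node `v`. -/
def addChild (T : UTree b) (v : ℕ) (hv : v ∈ T.labels v) (hc : #(T.labels v) = b) : UTree b where
  size := T.size + 1
  labels u := if u = T.size + 1 then {T.size + 1} else T.labels u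
  children u := if u = v then insert (T.size + 1) (T.children v) else T.children u
  labels_subset u i hi := by
    rw [mem_Icc]
    split_ifs at hi with h
    · rw [mem_singleton] at hi; omega
    · have := mem_Icc.1 (T.labels_subset u hi); omega
  existsUnique_labels i hi := by
    rw [mem_Icc] at hi
    by_cases h : i = T.size + 1
    · subst h
      refine ⟨T.size + 1, by simp, fun u hu => ?_⟩
      by_contra huv
      simp only [huv, if_false] at hu
      exact T.succ_size_notMem_labels u hu
    · obtain ⟨w, hw, hu⟩ := T.existsUnique_labels i (mem_Icc.2 (by omega))
      refine ⟨w, ?_, fun u hu' => hu u ?_⟩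
      · dsimp only
        rw [if_neg]
        · exact hw
        · have := T.le_size_of_mem_labels (T.name_eq_min w i hw).1
          omega
      · dsimp only at hu'
        split_ifs at hu' with huv
        · exact absurd (mem_singleton.1 hu') h
        · exact hu'
  name_eq_min u i hi := by
    split_ifs at hi ⊢ with h
    · rw [mem_singleton] at hi ⊢
      exact ⟨h, by omega⟩
    · exact T.name_eq_min u i hi
  card_labels_le u := by
    split_ifs with h
    -- The new bucket has one label, and `1 ≤ b` because the full bucket `v` is nonempty.
    · rw [card_singleton, ← hc]
      exact card_pos.2 ⟨v, hv⟩
    · exact T.card_labels_le u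
  children_nodes u w hw := by
    have hne : ∀ x, x ∈ T.labels x → x ≠ T.size + 1 := by
      rintro x hx rfl
      exact T.succ_size_notMem_labels _ hx
    split_ifs at hw with h
    · subst h
      rw [if_neg (hne u hv)]
      refine ⟨hv, ?_⟩
      rcases mem_insert.1 hw with rfl | hw
      · simp
      · have := (T.children_nodes u w hw).2
        rwa [if_neg (hne w this)]
    · obtain ⟨h1, h2⟩ := T.children_nodes u w hw
      rw [if_neg (hne u h1), if_neg (hne w h2)]
      exact ⟨h1, h2⟩
  existsUnique_parent w hw hw1 := by
    split_ifs at hw with h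
    · subst h
      refine ⟨v, by simp, fun u hu => ?_⟩
      by_contra huv
      simp only [huv, if_false] at hu
      exact T.succ_size_notMem_children u hu
    · obtain ⟨p, hp, hu⟩ := T.existsUnique_parent w hw hw1
      refine ⟨p, ?_, fun u hu' => hu u ?_⟩
      · dsimp only
        split_ifs with hpv
        · subst hpv; exact mem_insert_of_mem hp
        · exact hp
      · dsimp only at hu'
        split_ifs at hu' with huv
        · subst huv; exact (mem_insert.1 hu').resolve_left h
        · exact hu'
  saturated u hu := by
    have hne : ∀ x, x ∈ T.labels x → x ≠ T.size + 1 := by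
      rintro x hx rfl
      exact T.succ_size_notMem_labels _ hx
    split_ifs at hu with h
    · subst h
      rw [if_neg (hne u hv), hc]
    · obtain ⟨w, hw⟩ := hu
      rw [if_neg (hne u (T.children_nodes u w hw).1)]
      exact T.saturated u ⟨w, hw⟩
  increasing u w hw x hx y hy := by
    have hle : ∀ x z, x ∈ T.labels z → x < T.size + 1 := fun x z hx =>
      Nat.lt_succ_of_le (T.le_size_of_mem_labels hx)
    have hne : ∀ x, x ∈ T.labels x → x ≠ T.size + 1 := fun x hx => (hle x x hx).ne
    split_ifs at hw with h
    · subst h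
      rw [if_neg (hne u hv)] at hx
      rcases mem_insert.1 hw with rfl | hw
      · simp only [if_true, mem_singleton] at hy
        rw [hy]; exact hle x u hx
      · rw [if_neg (hne w (T.children_nodes u w hw).2)] at hy
        exact T.increasing u w hw x hx y hy
    · obtain ⟨h1, h2⟩ := T.children_nodes u w hw
      rw [if_neg (hne u h1)] at hx
      rw [if_neg (hne w h2)] at hy
      exact T.increasing u w hw x hx y hy

theorem le_size_of_mem_children (T : UTree b) {v w : ℕ} (h : w ∈ T.children v) : w ≤ T.size :=
  T.le_size_of_mem_labels (T.mem_labels_self_of_mem_children h)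

theorem addLabel_below (T : UTree b) (v : ℕ) (hv : v ∈ T.labels v) (hc : #(T.labels v) < b) :
    (T.addLabel v hv hc).below (T.size + 1) = T := by
  refine UTree.ext ?_ ?_ ?_
  · simp [below, addLabel]
  · funext u
    by_cases h : u = v
    · subst h
      simpa [below, addLabel, filter_insert] using fun _ => T.le_size_of_mem_labels
    · simpa [below, addLabel, h] using fun _ => T.le_size_of_mem_labels
  · funext u
    simpa [below, addLabel] using fun _ => T.le_size_of_mem_children

theorem addChild_below (T : UTree b) (v : ℕ) (hv : v ∈ T.labels v) (hc : #(T.labels v) = b) :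
    (T.addChild v hv hc).below (T.size + 1) = T := by
  refine UTree.ext ?_ ?_ ?_
  · simp [below, addChild]
  · funext u
    by_cases h : u = T.size + 1
    · subst h
      simp [below, addChild, filter_singleton, T.labels_eq_empty (T.succ_size_notMem_labels _)]
    · simpa [below, addChild, h] using fun _ => T.le_size_of_mem_labels
  · funext u
    by_cases h : u = v
    · subst h
      simpa [below, addChild, filter_insert] using fun _ => T.le_size_of_mem_children
    · simpa [below, addChild, h] using fun _ => T.le_size_of_mem_children

theorem addLabel_attracts (T : UTree b) (v : ℕ) (hv : v ∈ T.labels v) (hc : #(T.labels v) < b) :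
    (T.addLabel v hv hc).Attracts v (T.size + 1) :=
  Or.inr ⟨by have := T.le_size_of_mem_labels hv; omega, by simp [addLabel]⟩

theorem addChild_attracts (T : UTree b) (v : ℕ) (hv : v ∈ T.labels v) (hc : #(T.labels v) = b) :
    (T.addChild v hv hc).Attracts v (T.size + 1) :=
  Or.inl (by simp [addChild])

theorem Attracts.mem_labels {T : UTree b} {v j : ℕ} (h : T.Attracts v j) : v ∈ T.labels v := by
  rcases h with h | ⟨-, h⟩
  · exact (T.children_nodes v j h).1
  · exact (T.name_eq_min v j h).1

theorem Attracts.lt {T : UTree b} {v j : ℕ} (h : T.Attracts v j) : v < j := by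
  rcases h with h | ⟨hne, h⟩
  · obtain ⟨h1, h2⟩ := T.children_nodes v j h
    exact T.increasing v j h v h1 j h2
  · exact lt_of_le_of_ne (T.name_eq_min v j h).2 hne

theorem Attracts.mem_labels_below {T : UTree b} {v j : ℕ} (h : T.Attracts v j) :
    v ∈ (T.below j).labels v :=
  mem_filter.2 ⟨h.mem_labels, h.lt⟩

theorem below_size (T : UTree b) {n : ℕ} (h : T.size = n + 1) : (T.below (n + 1)).size = n := by
  simp [below, h]

theorem below_labels_eq (T : UTree b) {n v : ℕ} (h : T.size = n + 1) (hv : n + 1 ∉ T.labels v) :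
    (T.below (n + 1)).labels v = T.labels v := by
  refine filter_true_of_mem fun i hi => ?_
  have := T.le_size_of_mem_labels hi
  have : i ≠ n + 1 := fun e => hv (e ▸ hi)
  omega

theorem below_children_eq (T : UTree b) {n v : ℕ} (h : T.size = n + 1)
    (hv : n + 1 ∉ T.children v) : (T.below (n + 1)).children v = T.children v := by
  refine filter_true_of_mem fun i hi => ?_
  have := T.le_size_of_mem_labels (T.mem_labels_self_of_mem_children hi)
  have : i ≠ n + 1 := fun e => hv (e ▸ hi)
  omega

theorem insert_below_labels (T : UTree b) {n v : ℕ} (h : T.size = n + 1)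
    (hv : n + 1 ∈ T.labels v) : insert (n + 1) ((T.below (n + 1)).labels v) = T.labels v := by
  ext i
  simp only [below, mem_insert, mem_filter]
  constructor
  · rintro (rfl | h)
    exacts [hv, h.1]
  · intro hi
    have := T.le_size_of_mem_labels hi
    by_cases e : i = n + 1
    exacts [Or.inl e, Or.inr ⟨hi, by omega⟩]

theorem insert_below_children (T : UTree b) {n v : ℕ} (h : T.size = n + 1)
    (hv : n + 1 ∈ T.children v) :
    insert (n + 1) ((T.below (n + 1)).children v) = T.children v := by
  ext i
  simp only [below, mem_insert, mem_filter]
  constructor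
  · rintro (rfl | h)
    exacts [hv, h.1]
  · intro hi
    have := T.le_size_of_mem_labels (T.mem_labels_self_of_mem_children hi)
    by_cases e : i = n + 1
    exacts [Or.inl e, Or.inr ⟨hi, by omega⟩]

/-- A tree arises from its restriction to all labels but the largest by attaching this label to
the node that attracted it. -/
theorem eq_addLabel_or_addChild {T S : UTree b} {v : ℕ} (hs : T.size = S.size + 1)
    (hS : T.below (S.size + 1) = S) (hv : T.Attracts v (S.size + 1)) :
    ∃ hl : v ∈ S.labels v,
      (∃ hc : #(S.labels v) < b, T = S.addLabel v hl hc) ∨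
      (∃ hc : #(S.labels v) = b, T = S.addChild v hl hc) := by
  have hlt := hv.lt
  have hpos := T.one_le_of_mem_labels hv.mem_labels
  -- Naming the size removes `S` from the left side of `hS`, so that `S` can be substituted.
  obtain ⟨n, hn⟩ : ∃ n, S.size = n := ⟨_, rfl⟩
  rw [hn] at hs hS hv hlt
  subst hS
  refine ⟨hv.mem_labels_below, ?_⟩
  rcases hv with hv | ⟨hne, hv⟩
  · right
    have hl := T.mem_labels_self_of_mem_children hv
    have hlab : ∀ u, u ≠ n + 1 → (T.below (n + 1)).labels u = T.labels u := fun u hu =>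
      T.below_labels_eq hs fun h => hu (T.eq_of_mem_labels h hl)
    refine ⟨?_, ?_⟩
    · rw [hlab v hlt.ne]
      exact T.saturated v ⟨_, hv⟩
    · refine UTree.ext ?_ ?_ ?_
      · simp [addChild, hn, hs]
      · funext u
        simp only [addChild, hn]
        split_ifs with hu
        · subst hu
          ext i
          rw [mem_singleton]
          refine ⟨fun hi => ?_, fun hi => hi ▸ hl⟩
          have h1 := T.le_size_of_mem_labels hi
          have h2 := (T.name_eq_min _ i hi).2
          omega
        · exact (hlab u hu).symm
      · funext u
        simp only [addChild, hn]
        split_ifs with hu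
        · subst hu
          exact (T.insert_below_children hs hv).symm
        · exact (T.below_children_eq hs fun h =>
            hu ((T.existsUnique_parent _ hl (by omega)).unique h hv)).symm
  · left
    have hlab := T.insert_below_labels hs hv
    refine ⟨?_, ?_⟩
    · have h1 := T.card_labels_le v
      rw [← hlab, card_insert_of_notMem (by simp [below])] at h1
      exact h1
    · refine UTree.ext ?_ ?_ ?_
      · simp [addLabel, hn, hs]
      · funext u
        simp only [addLabel, hn]
        split_ifs with hu
        · subst hu; exact hlab.symm
        · exact (T.below_labels_eq hs fun h => hu (T.eq_of_mem_labels h hv)).symm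
      · funext u
        simp only [addLabel]
        -- A label inside an older bucket is not the name of a node, so it is nobody's child.
        exact (T.below_children_eq hs fun h =>
          hne (T.eq_of_mem_labels hv (T.mem_labels_self_of_mem_children h))).symm

end UTree

/-! ### Attracting nodes, degree sums and products over the nodes -/

namespace UTree

variable {b : ℕ}

theorem Attracts.attr_eq {T : UTree b} {v j : ℕ} (h : T.Attracts v j) (hj : j ≤ T.size) :
    T.attr j = v := by
  have h1 := T.one_le_of_mem_labels h.mem_labels
  have h2 := h.lt
  have hset : {u | T.Attracts u j} = {v} := by
    ext u
    refine ⟨fun hu => (T.existsUnique_attracts (by omega) hj).unique hu h, ?_⟩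
    rintro rfl
    exact h
  rw [attr, hset, csInf_singleton]

theorem attracts_attr (T : UTree b) {j : ℕ} (hj : 2 ≤ j) (hjn : j ≤ T.size) :
    T.Attracts (T.attr j) j := by
  obtain ⟨v, hv, -⟩ := T.existsUnique_attracts hj hjn
  rwa [hv.attr_eq hjn]

theorem below_below (T : UTree b) {i j : ℕ} (h : i ≤ j) : (T.below j).below i = T.below i := by
  refine UTree.ext ?_ ?_ ?_
  · simp only [below]; omega
  · funext v
    simp only [below, filter_filter]
    exact filter_congr fun x _ => by omega
  · funext v
    simp only [below, filter_filter]
    exact filter_congr fun x _ => by omega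

theorem attr_below (T : UTree b) {i j : ℕ} (h : i < j) : (T.below j).attr i = T.attr i := by
  simp [attr, Attracts, below, h]

/-- Later labels do not influence earlier steps. This lets the product of step probabilities be
split at its last factor in the inductions on the size. -/
theorem stepProb_below (p : GrowthRule) (T : UTree b) {i j : ℕ} (h : i < j) :
    (T.below j).stepProb p i = T.stepProb p i := by
  have : i ≤ (T.below j).size ↔ i ≤ T.size := by simp only [below]; omega
  simp only [stepProb, this, T.below_below h.le, T.attr_below h]

theorem one_mem_nodes (T : UTree b) (h : 1 ≤ T.size) : 1 ∈ T.nodes := by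
  obtain ⟨v, hv, -⟩ := T.existsUnique_labels 1 (mem_Icc.2 ⟨le_rfl, h⟩)
  obtain ⟨h1, h2⟩ := T.name_eq_min v 1 hv
  have := T.one_le_of_mem_labels h1
  obtain rfl : v = 1 := by omega
  exact T.mem_nodes.2 hv

/-- The buckets partition the set of labels. -/
theorem sum_cap (T : UTree b) : ∑ v ∈ T.nodes, T.cap v = T.size := by
  have : T.nodes.biUnion T.labels = Icc 1 T.size := by
    ext i
    rw [mem_biUnion]
    constructor
    · rintro ⟨v, -, h⟩
      exact T.labels_subset v h
    · intro hi
      obtain ⟨v, hv, -⟩ := T.existsUnique_labels i hi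
      exact ⟨v, T.mem_nodes.2 (T.name_eq_min v i hv).1, hv⟩
  have h := congrArg card this
  rw [card_biUnion] at h
  · simpa [cap] using h
  · exact fun u _ v _ huv => disjoint_left.2 fun i hu hv => huv (T.eq_of_mem_labels hu hv)

/-- The sets of children partition the nodes other than the root. -/
theorem sum_outdeg (T : UTree b) (hT : 1 ≤ T.size) :
    ∑ v ∈ T.nodes, T.outdeg v + 1 = #T.nodes := by
  have hne : ∀ v w, w ∈ T.children v → w ≠ 1 := by
    rintro v w h rfl
    obtain ⟨h1, h2⟩ := T.children_nodes v 1 h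
    have h3 := T.increasing v 1 h v h1 1 h2
    have h4 := T.one_le_of_mem_labels h1
    omega
  have : T.nodes.biUnion T.children = T.nodes.erase 1 := by
    ext w
    rw [mem_biUnion, mem_erase, mem_nodes]
    constructor
    · rintro ⟨v, -, h⟩
      exact ⟨hne v w h, T.mem_labels_self_of_mem_children h⟩
    · rintro ⟨h1, hw⟩
      obtain ⟨v, hv, -⟩ := T.existsUnique_parent w hw h1
      exact ⟨v, T.mem_nodes.2 (T.children_nodes v w hv).1, hv⟩
  have h := congrArg card this
  rw [card_biUnion] at h
  · have := card_erase_add_one (T.one_mem_nodes hT)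
    rw [← h] at this
    exact this
  · exact fun u _ v _ huv => disjoint_left.2 fun i hu hv => huv
      ((T.existsUnique_parent i (T.mem_labels_self_of_mem_children hu) (hne u i hu)).unique hu hv)

theorem outdeg_eq_zero (T : UTree b) {v : ℕ} (h : #(T.labels v) < b) : T.outdeg v = 0 := by
  rw [outdeg, card_eq_zero, ← not_nonempty_iff_eq_empty]
  exact fun hne => h.ne (T.saturated v hne)

/-- Only the factor of `v` changes; `R` is the product over the other nodes. The existential form
avoids dividing by a factor that may vanish, and a general `g` serves both the weight and the
product of factorials. -/
theorem prod_nodes_addLabel (T : UTree b) (v : ℕ) (hv : v ∈ T.labels v) (hc : #(T.labels v) < b)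
    (g : ℕ → ℕ → ℝ) : ∃ R : ℝ,
      ∏ u ∈ T.nodes, g (T.cap u) (T.outdeg u) = g (T.cap v) 0 * R ∧
      ∏ u ∈ (T.addLabel v hv hc).nodes,
        g ((T.addLabel v hv hc).cap u) ((T.addLabel v hv hc).outdeg u) =
        g (T.cap v + 1) 0 * R := by
  have hnodes : (T.addLabel v hv hc).nodes = T.nodes := by
    ext u
    simp only [mem_nodes, addLabel]
    split_ifs with h
    · subst h; simp [hv]
    · rfl
  refine ⟨∏ u ∈ T.nodes.erase v, g (T.cap u) (T.outdeg u), ?_, ?_⟩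
  · rw [← mul_prod_erase _ _ (T.mem_nodes.2 hv), T.outdeg_eq_zero hc]
  · rw [hnodes, ← mul_prod_erase _ _ (T.mem_nodes.2 hv)]
    have h0 := T.outdeg_eq_zero hc
    congr 1
    · have h1 : (T.addLabel v hv hc).cap v = T.cap v + 1 := by
        simp [cap, addLabel, T.succ_size_notMem_labels]
      rw [h1]
      exact congrArg _ h0
    · refine prod_congr rfl fun u hu => ?_
      have h1 : (T.addLabel v hv hc).cap u = T.cap u := by
        simp [cap, addLabel, ne_of_mem_erase hu]
      rw [h1]
      rfl

/-- The out-degree of `v` grows by one and a leaf of capacity one appears, which contributes `g 1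
0`. -/
theorem prod_nodes_addChild (T : UTree b) (v : ℕ) (hv : v ∈ T.labels v) (hc : #(T.labels v) = b)
    (g : ℕ → ℕ → ℝ) : ∃ R : ℝ,
      ∏ u ∈ T.nodes, g (T.cap u) (T.outdeg u) = g b (T.outdeg v) * R ∧
      ∏ u ∈ (T.addChild v hv hc).nodes,
        g ((T.addChild v hv hc).cap u) ((T.addChild v hv hc).outdeg u) =
        g 1 0 * (g b (T.outdeg v + 1) * R) := by
  have hnot : T.size + 1 ∉ T.nodes := by
    rw [mem_nodes]
    exact T.succ_size_notMem_labels _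
  have hne : ∀ u ∈ T.nodes, u ≠ T.size + 1 := fun u hu e => hnot (e ▸ hu)
  have hnodes : (T.addChild v hv hc).nodes = insert (T.size + 1) T.nodes := by
    ext u
    simp only [mem_insert, mem_nodes, addChild]
    split_ifs with h
    · simp [h]
    · simp [h]
  have hvn := T.mem_nodes.2 hv
  have hcap : ∀ u ∈ T.nodes, (T.addChild v hv hc).cap u = T.cap u := fun u hu => by
    simp [cap, addChild, hne u hu]
  refine ⟨∏ u ∈ T.nodes.erase v, g (T.cap u) (T.outdeg u), ?_, ?_⟩
  · rw [← mul_prod_erase _ _ hvn, show T.cap v = b from hc]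
  · rw [hnodes, prod_insert hnot, ← mul_prod_erase _ _ hvn]
    congr 1
    · have h1 : (T.addChild v hv hc).cap (T.size + 1) = 1 := by simp [cap, addChild]
      have h2 : (T.addChild v hv hc).outdeg (T.size + 1) = 0 := by
        simp [outdeg, addChild, (hne v hvn).symm,
          T.children_eq_empty (T.succ_size_notMem_labels _)]
      rw [h1, h2]
    · congr 1
      · have h2 : (T.addChild v hv hc).outdeg v = T.outdeg v + 1 := by
          simp [outdeg, addChild, T.succ_size_notMem_children]
        rw [hcap v hvn, h2, show T.cap v = b from hc]
      · refine prod_congr rfl fun u hu => ?_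
        have h2 : (T.addChild v hv hc).outdeg u = T.outdeg u := by
          simp [outdeg, addChild, ne_of_mem_erase hu]
        rw [hcap u (mem_of_mem_erase hu), h2]

/-- If a node of out-degree `k` attracts the next label, then the product of the factorials of the
out-degrees is multiplied by `k + 1` (for an unsaturated node `k = 0`, and nothing changes). -/
theorem prod_factorial_outdeg {T S : UTree b} {v : ℕ} (hs : T.size = S.size + 1)
    (hS : T.below (S.size + 1) = S) (hv : T.Attracts v (S.size + 1)) :
    ∏ u ∈ T.nodes, ((T.outdeg u).factorial : ℝ) =
      (∏ u ∈ S.nodes, ((S.outdeg u).factorial : ℝ)) * ((S.outdeg v : ℝ) + 1) := by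
  obtain ⟨hl, ⟨hc, rfl⟩ | ⟨hc, rfl⟩⟩ := eq_addLabel_or_addChild hs hS hv
  · obtain ⟨R, h1, h2⟩ := S.prod_nodes_addLabel v hl hc fun _ k => (k.factorial : ℝ)
    rw [h1, h2, S.outdeg_eq_zero hc]
    simp
  · obtain ⟨R, h1, h2⟩ := S.prod_nodes_addChild v hl hc fun _ k => (k.factorial : ℝ)
    rw [h1, h2, Nat.factorial_succ]
    push_cast
    ring

end UTree

/-! ### The common affine form of the growth rules and their weights -/

/-- The product `∏_{1 ≤ j ≤ m} (A j + B)`. -/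
noncomputable def affineProd (A B : ℝ) (m : ℕ) : ℝ := ∏ j ∈ range m, (A * (j + 1) + B)

theorem affineProd_zero (A B : ℝ) : affineProd A B 0 = 1 := by simp [affineProd]

theorem affineProd_succ (A B : ℝ) (m : ℕ) :
    affineProd A B (m + 1) = affineProd A B m * (A * (m + 1) + B) := prod_range_succ _ _

/-- The common form `p(v) = (A c(v) + B (1 - deg⁺(v))) / (A n + B)` of the three growth rules. -/
noncomputable def affineRule (A B : ℝ) : GrowthRule := fun c deg n =>
  (A * c + B * (1 - deg)) / (A * n + B)

/-- The weight sequences that belong to the growth rule `affineRule A B`. -/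
structure AffineWeights (b : ℕ) (A B : ℝ) (φ ψ : ℕ → ℝ) : Prop where
  pos : ∀ n : ℕ, 1 ≤ n → 0 < A * n + B
  φ_nonneg : ∀ k, 0 ≤ φ k
  φ_zero : φ 0 = affineProd A B (b - 1)
  ψ_eq : ∀ k, 1 ≤ k → k < b → ψ k = affineProd A B (k - 1)
  φ_succ : ∀ k : ℕ, ((k : ℝ) + 1) * φ (k + 1) = (A * b + B * (1 - k)) * φ k

namespace AffineWeights

variable {b : ℕ} {A B : ℝ} {φ ψ : ℕ → ℝ}

theorem affineProd_pos (h : AffineWeights b A B φ ψ) (m : ℕ) : 0 < affineProd A B m :=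
  prod_pos fun j _ => by simpa using h.pos (j + 1) (by omega)

/-- The value `φ 0` continues the sequence `ψ`, so leaves need no distinction between full and
unsaturated buckets. This also covers `b = 1`, where a new leaf is already full. -/
theorem leaf_weight (h : AffineWeights b A B φ ψ) {c : ℕ} (hc : c + 1 ≤ b) :
    (if c + 1 = b then φ 0 else ψ (c + 1)) = affineProd A B c := by
  split_ifs with hcb
  · rw [h.φ_zero, ← hcb, Nat.add_sub_cancel]
  · rw [h.ψ_eq (c + 1) (by omega) (by omega), Nat.add_sub_cancel]

/-- For an unsaturated `v` the out-degree is zero and consecutive leaf weights differ by the factor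
`A c(v) + B`. For a saturated `v` the new leaf has weight one and the recurrence `φ_succ` supplies
the factor. The form without division also holds for trees of weight zero. -/
theorem weight_mul (h : AffineWeights b A B φ ψ) {T S : UTree b} {v : ℕ}
    (hs : T.size = S.size + 1) (hS : T.below (S.size + 1) = S)
    (hv : T.Attracts v (S.size + 1)) :
    T.weight φ ψ * ((S.outdeg v : ℝ) + 1) =
      S.weight φ ψ * (A * S.cap v + B * (1 - S.outdeg v)) := by
  obtain ⟨hl, hT⟩ := UTree.eq_addLabel_or_addChild hs hS hv
  have hpos : 0 < S.cap v := card_pos.2 ⟨v, hl⟩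
  obtain ⟨c, hcap⟩ : ∃ c, S.cap v = c + 1 := ⟨S.cap v - 1, by omega⟩
  rcases hT with ⟨hc, rfl⟩ | ⟨hc, rfl⟩
  · obtain ⟨R, h1, h2⟩ := S.prod_nodes_addLabel v hl hc fun c k => if c = b then φ k else ψ c
    rw [UTree.weight, UTree.weight, h1, h2, S.outdeg_eq_zero hc, hcap,
      h.leaf_weight (c := c + 1) (by rw [← hcap]; exact hc),
      h.leaf_weight (c := c) (by rw [← hcap]; exact hc.le), affineProd_succ]
    push_cast
    ring
  · obtain ⟨R, h1, h2⟩ := S.prod_nodes_addChild v hl hc fun c k => if c = b then φ k else ψ c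
    have hb : S.cap v = b := hc
    have h10 := h.leaf_weight (c := 0) (by omega)
    rw [zero_add] at h10
    rw [UTree.weight, UTree.weight, h1, h2, hb, h10, affineProd_zero]
    simp only [if_true]
    linear_combination R * h.φ_succ (S.outdeg v)

end AffineWeights

namespace UTree

theorem sum_affine {b : ℕ} (A B : ℝ) (T : UTree b) (hT : 1 ≤ T.size) :
    ∑ v ∈ T.nodes, (A * T.cap v + B * (1 - T.outdeg v)) = A * T.size + B := by
  have h1 : ∑ v ∈ T.nodes, (T.cap v : ℝ) = T.size := by exact_mod_cast T.sum_cap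
  have h2 : ∑ v ∈ T.nodes, (T.outdeg v : ℝ) + 1 = #T.nodes := by exact_mod_cast T.sum_outdeg hT
  rw [sum_add_distrib, ← mul_sum, ← mul_sum, h1, sum_sub_distrib, sum_const, nsmul_one, ← h2]
  ring

end UTree

/-! ### Ordered trees and the number of their extensions -/

namespace OTree

variable {b : ℕ}

theorem length_order (T : OTree b) (v : ℕ) : (T.order v).length = T.outdeg v := by
  rw [UTree.outdeg, ← T.order_toFinset, List.toFinset_card_of_nodup (T.order_nodup v)]

theorem mem_order (T : OTree b) {v w : ℕ} : w ∈ T.order v ↔ w ∈ T.children v := by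
  rw [← T.order_toFinset, List.mem_toFinset]

theorem succ_size_notMem_order (T : OTree b) (v : ℕ) : T.size + 1 ∉ T.order v := fun h =>
  T.succ_size_notMem_children v (T.mem_order.1 h)

/-- Add the label `size + 1` to the unsaturated node `v`. -/
def addLabel (T : OTree b) (v : ℕ) (hv : v ∈ T.labels v) (hc : #(T.labels v) < b) : OTree b where
  toUTree := T.toUTree.addLabel v hv hc
  order := T.order
  order_nodup := T.order_nodup
  order_toFinset := T.order_toFinset

/-- Add a new child with the only label `size + 1` to the saturated node `v`, with `i` children to
the left of it. -/
def addChild (T : OTree b) (v : ℕ) (hv : v ∈ T.labels v) (hc : #(T.labels v) = b) (i : ℕ) :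
    OTree b where
  toUTree := T.toUTree.addChild v hv hc
  order u := if u = v then (T.order v).take i ++ (T.size + 1) :: (T.order v).drop i else T.order u
  order_nodup u := by
    split_ifs with h
    · rw [List.nodup_middle, List.take_append_drop, List.nodup_cons]
      exact ⟨T.succ_size_notMem_order v, T.order_nodup v⟩
    · exact T.order_nodup u
  order_toFinset u := by
    ext w
    simp only [UTree.addChild]
    split_ifs with h
    · rw [List.mem_toFinset, List.perm_middle.mem_iff, List.take_append_drop, mem_insert,
        List.mem_cons, mem_order]
    · rw [List.mem_toFinset, mem_order]

theorem ext_of_toUTree {S T : OTree b} (h : S.toUTree = T.toUTree) (ho : S.order = T.order) :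
    S = T := by
  cases S; cases T; simp_all

theorem filter_order (T : OTree b) (v : ℕ) :
    (T.order v).filter (· < T.size + 1) = T.order v :=
  List.filter_eq_self.2 fun w hw => by
    have := T.le_size_of_mem_children (T.mem_order.1 hw)
    simpa using Nat.lt_succ_of_le this

theorem addLabel_below (T : OTree b) (v : ℕ) (hv : v ∈ T.labels v) (hc : #(T.labels v) < b) :
    (T.addLabel v hv hc).below (T.size + 1) = T :=
  ext_of_toUTree (T.toUTree.addLabel_below v hv hc) (funext fun u => T.filter_order u)

theorem addChild_below (T : OTree b) (v : ℕ) (hv : v ∈ T.labels v) (hc : #(T.labels v) = b)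
    (i : ℕ) : (T.addChild v hv hc i).below (T.size + 1) = T := by
  refine ext_of_toUTree (T.toUTree.addChild_below v hv hc) (funext fun u => ?_)
  by_cases h : u = v
  · subst h
    have h1 : ((T.order u).take i ++ (T.size + 1) :: (T.order u).drop i).filter
        (· < T.size + 1) = (T.order u).filter (· < T.size + 1) := by
      conv_rhs => rw [← List.take_append_drop i (T.order u)]
      rw [List.filter_append, List.filter_append, List.filter_cons_of_neg (by simp)]
    simpa only [below, addChild, if_true] using h1.trans (T.filter_order u)
  · simpa only [below, addChild, h, if_false] using T.filter_order u

/-- The index of the new label in the list of children recovers `i`, provided that `i` is at most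
the length of the old list. -/
theorem addChild_injOn (T : OTree b) (v : ℕ) (hv : v ∈ T.labels v) (hc : #(T.labels v) = b) :
    Set.InjOn (T.addChild v hv hc) (range (T.outdeg v + 1)) := by
  intro i hi j hj hij
  have key : ∀ k ∈ range (T.outdeg v + 1),
      ((T.addChild v hv hc k).order v).idxOf (T.size + 1) = k := by
    intro k hk
    rw [mem_range, ← T.length_order] at hk
    have h1 : T.size + 1 ∉ (T.order v).take k := fun h =>
      T.succ_size_notMem_order v (List.mem_of_mem_take h)
    simp only [addChild, if_true]
    rw [List.idxOf_append_of_notMem h1, List.idxOf_cons_self, List.length_take]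
    omega
  rw [← key i hi, ← key j hj]
  exact congrArg (fun T' : OTree b => (T'.order v).idxOf (T.size + 1)) hij

theorem order_eq_of_below {T S : OTree b} {n v : ℕ} (hS : T.below (n + 1) = S)
    (hs : T.size = n + 1) (hv : n + 1 ∉ T.children v) : T.order v = S.order v := by
  subst hS
  refine (List.filter_eq_self.2 fun w hw => ?_).symm
  rw [mem_order] at hw
  have h1 := T.le_size_of_mem_children hw
  have h2 : w ≠ n + 1 := fun e => hv (e ▸ hw)
  simp only [decide_eq_true_eq]
  omega

theorem eq_addLabel_or_addChild {T S : OTree b} {v : ℕ} (hs : T.size = S.size + 1)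
    (hS : T.below (S.size + 1) = S) (hv : T.Attracts v (S.size + 1)) :
    ∃ hl : v ∈ S.labels v,
      (∃ hc : #(S.labels v) < b, T = S.addLabel v hl hc) ∨
      (∃ hc : #(S.labels v) = b, ∃ i ∈ range (S.outdeg v + 1), T = S.addChild v hl hc i) := by
  have hS' : T.toUTree.below (S.size + 1) = S.toUTree := congrArg OTree.toUTree hS
  obtain ⟨hl, ⟨hc, hT⟩ | ⟨hc, hT⟩⟩ := UTree.eq_addLabel_or_addChild hs hS' hv
  · refine ⟨hl, Or.inl ⟨hc, ext_of_toUTree hT (funext fun u => ?_)⟩⟩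
    refine (order_eq_of_below hS hs ?_ : T.order u = S.order u)
    rw [hT]
    exact S.succ_size_notMem_children u
  · refine ⟨hl, Or.inr ⟨hc, ?_⟩⟩
    have hmem : S.size + 1 ∈ T.order v := by
      rw [mem_order, hT]
      simp [UTree.addChild]
    -- The insertion place is the length of the part of the list to the left of the new label.
    obtain ⟨l, r, hlr⟩ := List.append_of_mem hmem
    have hnd := T.order_nodup v
    rw [hlr, List.nodup_middle, List.nodup_cons] at hnd
    have hle : ∀ w ∈ l ++ r, w < S.size + 1 := fun w hw => by
      have h1 : w ∈ T.order v := by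
        rw [hlr, List.perm_middle.mem_iff]
        exact List.mem_cons_of_mem _ hw
      have h2 := T.le_size_of_mem_children (T.mem_order.1 h1)
      have h3 : w ≠ S.size + 1 := fun e => hnd.1 (e ▸ hw)
      omega
    have hSv : S.order v = l ++ r := by
      have h1 : (T.order v).filter (· < S.size + 1) = S.order v :=
        congrArg (fun T' : OTree b => T'.order v) hS
      rw [← h1, hlr, List.filter_append, List.filter_cons_of_neg (by simp), ← List.filter_append]
      exact List.filter_eq_self.2 fun w hw => by simpa using hle w hw
    refine ⟨l.length, ?_, ext_of_toUTree hT (funext fun u => ?_)⟩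
    · rw [mem_range, ← S.length_order, hSv, List.length_append]
      omega
    · by_cases hu : u = v
      · subst hu
        simp [addChild, hSv, hlr]
      · simp only [addChild, hu, if_false]
        refine order_eq_of_below hS hs ?_
        rw [hT]
        simpa [UTree.addChild, hu] using S.succ_size_notMem_children u

open Classical in
/-- The trees that arise from `S` if the node `v` attracts the next label. -/
noncomputable def extensions (S : OTree b) (v : ℕ) : Finset (OTree b) :=
  (trees b (S.size + 1)).filter
    fun T => T.below (S.size + 1) = S ∧ T.Attracts v (S.size + 1)

theorem mem_extensions {S T : OTree b} {v : ℕ} : T ∈ S.extensions v ↔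
    T.size = S.size + 1 ∧ T.below (S.size + 1) = S ∧ T.Attracts v (S.size + 1) := by
  classical
  rw [extensions, mem_filter, mem_trees]

/-- A saturated node offers one place more than it has children. An unsaturated node has no children
and admits a single extension, so the same formula holds. -/
theorem card_extensions (S : OTree b) {v : ℕ} (hv : v ∈ S.nodes) :
    #(S.extensions v) = S.outdeg v + 1 := by
  classical
  have hl := S.mem_nodes.1 hv
  rcases (S.card_labels_le v).lt_or_eq with hc | hc
  · have : S.extensions v = {S.addLabel v hl hc} := by
      ext T
      rw [mem_extensions, mem_singleton]
      constructor
      · rintro ⟨hs, hS, hT⟩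
        obtain ⟨_, ⟨_, h⟩ | ⟨h, _⟩⟩ := eq_addLabel_or_addChild hs hS hT
        · exact h
        · exact absurd h hc.ne
      · rintro rfl
        exact ⟨rfl, S.addLabel_below v hl hc, S.toUTree.addLabel_attracts v hl hc⟩
    rw [this, card_singleton, S.outdeg_eq_zero hc]
  · have : S.extensions v = (range (S.outdeg v + 1)).image (S.addChild v hl hc) := by
      ext T
      rw [mem_extensions, mem_image]
      constructor
      · rintro ⟨hs, hS, hT⟩
        obtain ⟨_, ⟨h, _⟩ | ⟨_, i, hi, h⟩⟩ := eq_addLabel_or_addChild hs hS hT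
        · exact absurd hc h.ne
        · exact ⟨i, hi, h.symm⟩
      · rintro ⟨i, -, rfl⟩
        exact ⟨rfl, S.addChild_below v hl hc i, S.toUTree.addChild_attracts v hl hc⟩
    rw [this, card_image_of_injOn (S.addChild_injOn v hl hc), card_range]

/-- The tree with the single label `1`. -/
def single (b : ℕ) (hb : 1 ≤ b) : OTree b where
  size := 1
  labels v := if v = 1 then {1} else ∅
  children _ := ∅
  labels_subset v := by split_ifs <;> simp
  existsUnique_labels i hi := by
    obtain rfl : i = 1 := by simpa using hi
    exact ⟨1, by simp, fun v hv => by by_contra h; simp [h] at hv⟩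
  name_eq_min v i hi := by
    split_ifs at hi ⊢ with h
    · simp_all
    · simp at hi
  card_labels_le v := by split_ifs <;> simp [hb]
  children_nodes v w hw := by simp at hw
  existsUnique_parent w hw hw1 := by simp [hw1] at hw
  saturated v hv := by simp at hv
  increasing v w hw := by simp at hw
  order _ := []
  order_nodup _ := List.nodup_nil
  order_toFinset _ := rfl

end OTree

/-! ### The tree of size one, base of the inductions -/

theorem UTree.eq_single {b : ℕ} (hb : 1 ≤ b) {T : UTree b} (hT : T.size = 1) :
    T = (OTree.single b hb).toUTree := by
  have h1 : ∀ v i, i ∈ T.labels v → i = 1 := fun v i hi => by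
    have h1 := T.one_le_of_mem_labels hi
    have h2 := T.le_size_of_mem_labels hi
    omega
  have h11 := T.mem_nodes.1 (T.one_mem_nodes hT.ge)
  refine UTree.ext hT (funext fun v => ?_) (funext fun v => ?_)
  · simp only [OTree.single]
    split_ifs with h
    · subst h
      ext i
      rw [mem_singleton]
      exact ⟨h1 1 i, fun e => e ▸ h11⟩
    · exact T.labels_eq_empty fun hv => h (h1 v v hv)
  · refine eq_empty_of_forall_notMem fun w hw => ?_
    obtain ⟨h2, h3⟩ := T.children_nodes v w hw
    have := T.increasing v w hw v h2 w h3
    have := h1 v v h2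
    have := h1 w w h3
    omega

theorem trees_one {b : ℕ} (hb : 1 ≤ b) : trees b 1 = {OTree.single b hb} := by
  ext T
  rw [mem_trees, mem_singleton]
  refine ⟨fun hT => ?_, fun h => h ▸ rfl⟩
  have h := UTree.eq_single hb hT
  refine OTree.ext_of_toUTree h (funext fun v => ?_)
  refine List.eq_nil_iff_forall_not_mem.2 fun w hw => ?_
  rw [OTree.mem_order, h] at hw
  simp [OTree.single] at hw

theorem UTree.nodes_of_size_eq_one {b : ℕ} (hb : 1 ≤ b) {T : UTree b} (hT : T.size = 1) :
    T.nodes = {1} := by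
  rw [UTree.eq_single hb hT]
  ext v
  simp only [UTree.mem_nodes, OTree.single, mem_singleton]
  split_ifs with h <;> simp [h]

theorem UTree.outdeg_of_size_eq_one {b : ℕ} (hb : 1 ≤ b) {T : UTree b} (hT : T.size = 1) (v : ℕ) :
    T.outdeg v = 0 := by
  rw [UTree.eq_single hb hT]
  rfl

theorem UTree.cap_of_size_eq_one {b : ℕ} (hb : 1 ≤ b) {T : UTree b} (hT : T.size = 1) :
    T.cap 1 = 1 := by
  rw [UTree.eq_single hb hT]
  rfl

theorem OTree.sum_treeProb {b n : ℕ} (φ ψ : ℕ → ℝ) {F : Finset (OTree b)}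
    (hF : ∀ T ∈ F, T.size = n) :
    ∑ T ∈ F, T.treeProb φ ψ = (∑ T ∈ F, T.weight φ ψ) / total b φ ψ n := by
  rw [sum_div]
  exact sum_congr rfl fun T hT => by rw [OTree.treeProb, hF T hT]

/-! ### Total weights and the equality of the two models -/

namespace AffineWeights

variable {b : ℕ} {A B : ℝ} {φ ψ : ℕ → ℝ}

theorem weight_of_size_eq_one (h : AffineWeights b A B φ ψ) (hb : 1 ≤ b) {T : UTree b}
    (hT : T.size = 1) : T.weight φ ψ = 1 := by
  rw [UTree.weight, UTree.nodes_of_size_eq_one hb hT, prod_singleton,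
    UTree.outdeg_of_size_eq_one hb hT, UTree.cap_of_size_eq_one hb hT]
  have := h.leaf_weight (c := 0) hb
  rwa [zero_add, affineProd_zero] at this

/-- All extensions at `v` have the same weight, and their number cancels the denominator `deg⁺ v +
1`. -/
theorem sum_extensions (h : AffineWeights b A B φ ψ) (S : OTree b) {v : ℕ} (hv : v ∈ S.nodes) :
    ∑ T ∈ S.extensions v, T.weight φ ψ =
      S.weight φ ψ * (A * S.cap v + B * (1 - S.outdeg v)) := by
  have hne : (S.outdeg v : ℝ) + 1 ≠ 0 := by positivity
  have : ∀ T ∈ S.extensions v, T.weight φ ψ =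
      S.weight φ ψ * (A * S.cap v + B * (1 - S.outdeg v)) / ((S.outdeg v : ℝ) + 1) := by
    intro T hT
    obtain ⟨h1, h2, h3⟩ := OTree.mem_extensions.1 hT
    rw [eq_div_iff hne]
    exact h.weight_mul h1 (congrArg OTree.toUTree h2) h3
  rw [sum_congr rfl this, sum_const, S.card_extensions hv, nsmul_eq_mul]
  push_cast
  field_simp

-- The extensions of `S` are grouped by the unique node that attracts the new label; the numerators
-- then add up by `UTree.sum_affine`.
open Classical in
theorem sum_below_eq (h : AffineWeights b A B φ ψ) (S : OTree b) (hS : 1 ≤ S.size) :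
    ∑ T ∈ (trees b (S.size + 1)).filter (fun T => T.below (S.size + 1) = S), T.weight φ ψ =
      S.weight φ ψ * (A * S.size + B) := by
  rw [← S.sum_affine A B hS, mul_sum,
    ← sum_congr rfl (fun v hv => h.sum_extensions S hv),
    ← sum_fiberwise_of_maps_to (g := fun T : OTree b => T.attr (S.size + 1)) (t := S.nodes)]
  · refine sum_congr rfl fun v _ => sum_congr ?_ fun _ _ => rfl
    ext T
    rw [mem_filter, mem_filter, mem_trees, OTree.mem_extensions, and_assoc]
    refine and_congr_right fun hs => and_congr_right fun _ => ⟨?_, fun hv => hv.attr_eq hs.ge⟩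
    rintro rfl
    exact T.attracts_attr (by omega) hs.ge
  · intro T hT
    rw [mem_filter, mem_trees] at hT
    have h1 := (T.attracts_attr (j := S.size + 1) (by omega) hT.1.ge).mem_labels_below
    rw [show T.toUTree.below (S.size + 1) = S.toUTree from congrArg OTree.toUTree hT.2] at h1
    exact S.mem_nodes.2 h1

/-- Every tree of size `n + 1` extends exactly one tree of size `n`, its restriction. -/
theorem total_succ (h : AffineWeights b A B φ ψ) {n : ℕ} (hn : 1 ≤ n) :
    total b φ ψ (n + 1) = total b φ ψ n * (A * n + B) := by
  classical
  rw [total, total, sum_mul,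
    ← sum_fiberwise_of_maps_to (g := fun T : OTree b => T.below (n + 1)) (t := trees b n)]
  · refine sum_congr rfl fun S hS => ?_
    obtain rfl := mem_trees.1 hS
    exact h.sum_below_eq S hn
  · exact fun T hT => mem_trees.2 (T.toUTree.below_size (mem_trees.1 hT))

theorem total_eq (h : AffineWeights b A B φ ψ) (hb : 1 ≤ b) (n : ℕ) :
    total b φ ψ (n + 1) = affineProd A B n := by
  induction n with
  | zero =>
    rw [affineProd_zero, zero_add, total, trees_one hb, sum_singleton,
      h.weight_of_size_eq_one hb rfl]
  | succ n ih =>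
    rw [h.total_succ (by omega), ih, affineProd_succ]
    push_cast
    rfl

theorem total_pos (h : AffineWeights b A B φ ψ) (hb : 1 ≤ b) {n : ℕ} (hn : 1 ≤ n) :
    0 < total b φ ψ n := by
  obtain ⟨m, rfl⟩ := Nat.exists_eq_add_of_le' hn
  rw [h.total_eq hb]
  exact h.affineProd_pos m

/-- Both sums in the conditional probability contain the factor `w(S) / T_{n+1}`, which cancels
because `w(S) ≠ 0`. -/
theorem attractionProb_eq (h : AffineWeights b A B φ ψ) (hb : 1 ≤ b) (S : OTree b)
    (hS : 1 ≤ S.size) (hw : S.weight φ ψ ≠ 0) {v : ℕ} (hv : v ∈ S.nodes) :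
    S.attractionProb φ ψ v = S.growth (affineRule A B) v := by
  classical
  have ht := (h.total_pos hb (n := S.size + 1) (by omega)).ne'
  have h1 : ∑ T ∈ S.extensions v, T.treeProb φ ψ = _ :=
    OTree.sum_treeProb φ ψ fun T hT => (OTree.mem_extensions.1 hT).1
  have h2 : ∑ T ∈ (trees b (S.size + 1)).filter (fun T => T.below (S.size + 1) = S),
      T.treeProb φ ψ = _ :=
    OTree.sum_treeProb φ ψ fun T hT => mem_trees.1 (mem_filter.1 hT).1
  rw [h.sum_extensions S hv] at h1
  rw [h.sum_below_eq S hS] at h2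
  have h3 : S.attractionProb φ ψ v = (∑ T ∈ S.extensions v, T.treeProb φ ψ) /
      ∑ T ∈ (trees b (S.size + 1)).filter (fun T => T.below (S.size + 1) = S),
        T.treeProb φ ψ := rfl
  rw [h3, h1, h2, div_div_div_cancel_right₀ ht, mul_div_mul_left _ _ hw]
  rfl

theorem stepProb_eq {T : UTree b} {n v : ℕ} (hs : T.size = n + 1) (hv : T.Attracts v (n + 1)) :
    T.stepProb (affineRule A B) (n + 1) =
      (A * (T.below (n + 1)).cap v + B * (1 - (T.below (n + 1)).outdeg v)) / (A * n + B) := by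
  rw [UTree.stepProb, if_pos hs.ge, UTree.growth, affineRule, T.below_size hs, hv.attr_eq hs.ge]

/-- Removing the largest label divides both sides by the same factor: `weight_mul` governs the
weight and `total_succ` the normalization. -/
theorem evolProb_ordered (h : AffineWeights b A B φ ψ) (hb : 1 ≤ b) (n : ℕ) :
    ∀ T : OTree b, T.size = n + 1 → T.evolProb (affineRule A B) = T.treeProb φ ψ := by
  induction n with
  | zero =>
    intro T hT
    rw [OTree.evolProb, OTree.treeProb, hT, h.total_eq hb, affineProd_zero,
      h.weight_of_size_eq_one hb hT]
    simp
  | succ n ih =>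
    intro T hT
    have hS := T.toUTree.below_size hT
    have hv := T.attracts_attr (j := n + 1 + 1) (by omega) hT.ge
    have hw := h.weight_mul (T := T.toUTree) (S := T.toUTree.below (n + 1 + 1))
      (v := T.attr (n + 1 + 1)) (by rw [hS, hT]) (by rw [hS]) (by rwa [hS])
    have ih' := ih (T.below (n + 1 + 1)) hS
    rw [OTree.evolProb, OTree.treeProb] at ih' ⊢
    have hprod : ∀ j ∈ Icc 2 (n + 1),
        T.toUTree.stepProb (affineRule A B) j /
          (((T.toUTree.below j).outdeg (T.attr j) : ℝ) + 1) =
        (T.below (n + 1 + 1)).toUTree.stepProb (affineRule A B) j /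
          ((((T.below (n + 1 + 1)).toUTree.below j).outdeg
            ((T.below (n + 1 + 1)).attr j) : ℝ) + 1) := by
      intro j hj
      have hj' : j < n + 1 + 1 := by
        rw [mem_Icc] at hj
        omega
      change _ = (T.toUTree.below (n + 1 + 1)).stepProb (affineRule A B) j /
          ((((T.toUTree.below (n + 1 + 1)).below j).outdeg
            ((T.toUTree.below (n + 1 + 1)).attr j) : ℝ) + 1)
      rw [T.toUTree.stepProb_below _ hj', T.toUTree.below_below hj'.le, T.toUTree.attr_below hj']
    have hS' : (T.below (n + 1 + 1)).size = n + 1 := hS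
    rw [hS'] at ih'
    rw [hT, prod_Icc_succ_top (by omega), prod_congr rfl hprod, ih',
      h.total_succ (n := n + 1) (by omega),
      stepProb_eq hT hv]
    change (T.toUTree.below (n + 1 + 1)).weight φ ψ / _ * _ = _
    have h1 := (h.total_pos hb (n := n + 1) (by omega)).ne'
    have h2 := (h.pos (n + 1) (by omega)).ne'
    have h3 : ((T.toUTree.below (n + 1 + 1)).outdeg (T.attr (n + 1 + 1)) : ℝ) + 1 ≠ 0 := by
      positivity
    rw [← eq_div_iff h3] at hw
    rw [hw]
    field_simp

/-- As in the ordered case, but the factor `deg⁺ v + 1` from `weight_mul` is now absorbed by the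
product of factorials. -/
theorem evolProb_unordered (h : AffineWeights b A B φ ψ) (hb : 1 ≤ b) (n : ℕ) :
    ∀ T : UTree b, T.size = n + 1 → T.evolProb (affineRule A B) = T.treeProb φ ψ := by
  induction n with
  | zero =>
    intro T hT
    rw [UTree.evolProb, UTree.treeProb, hT, h.total_eq hb, affineProd_zero,
      show T.sorted.weight φ ψ = 1 from h.weight_of_size_eq_one hb hT]
    simp [UTree.outdeg_of_size_eq_one hb hT]
  | succ n ih =>
    intro T hT
    have hS := T.below_size hT
    have hv := T.attracts_attr (j := n + 1 + 1) (by omega) hT.ge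
    have hs : T.size = (T.below (n + 1 + 1)).size + 1 := by rw [hS, hT]
    have hb' : T.below ((T.below (n + 1 + 1)).size + 1) = T.below (n + 1 + 1) := by rw [hS]
    have hv' : T.Attracts (T.attr (n + 1 + 1)) ((T.below (n + 1 + 1)).size + 1) := by rwa [hS]
    have hw := h.weight_mul hs hb' hv'
    have hf := UTree.prod_factorial_outdeg hs hb' hv'
    have ih' := ih (T.below (n + 1 + 1)) hS
    rw [UTree.evolProb, UTree.treeProb] at ih' ⊢
    have hprod : ∀ j ∈ Icc 2 (n + 1), T.stepProb (affineRule A B) j =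
        (T.below (n + 1 + 1)).stepProb (affineRule A B) j := by
      intro j hj
      rw [mem_Icc] at hj
      rw [T.stepProb_below _ (by omega)]
    rw [hS] at ih'
    rw [hT, prod_Icc_succ_top (by omega), prod_congr rfl hprod, ih',
      h.total_succ (n := n + 1) (by omega),
      stepProb_eq hT hv, hf]
    change (T.below (n + 1 + 1)).weight φ ψ * _ / _ * _ = T.weight φ ψ * _ / _
    have h1 := (h.total_pos hb (n := n + 1) (by omega)).ne'
    have h2 := (h.pos (n + 1) (by omega)).ne'
    rw [div_mul_div_comm]
    congr 1
    linear_combination (-∏ u ∈ (T.below (n + 1 + 1)).nodes,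
      (((T.below (n + 1 + 1)).outdeg u).factorial : ℝ)) * hw

theorem realizes (h : AffineWeights b A B φ ψ) (hb : 1 ≤ b) :
    Realizes b (affineRule A B) φ ψ where
  φ_nonneg := h.φ_nonneg
  φ_zero_pos := h.φ_zero ▸ h.affineProd_pos _
  ψ_nonneg k hk hkb := h.ψ_eq k hk hkb ▸ (h.affineProd_pos _).le
  attraction T hT hw _ hv := h.attractionProb_eq hb T hT hw hv
  unordered T hT := h.evolProb_unordered hb (T.size - 1) T (by omega)
  ordered T hT := h.evolProb_ordered hb (T.size - 1) T (by omega)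

end AffineWeights

/-! ### Binomial coefficients and series -/

theorem succ_mul_multichoose_succ (r : ℝ) (n : ℕ) :
    ((n : ℝ) + 1) * Ring.multichoose r (n + 1) = (r + n) * Ring.multichoose r n := by
  have key : ∀ m : ℕ, (m.factorial : ℝ) * Ring.multichoose r m = (ascPochhammer ℝ m).eval r := by
    intro m
    rw [← nsmul_eq_mul, Ring.factorial_nsmul_multichoose_eq_ascPochhammer,
      Polynomial.ascPochhammer_smeval_eq_eval]
  have h1 := key (n + 1)
  rw [ascPochhammer_succ_eval, ← key n, Nat.factorial_succ] at h1
  push_cast at h1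
  have h2 : (n.factorial : ℝ) ≠ 0 := by positivity
  apply mul_left_cancel₀ h2
  linear_combination h1

theorem affineProd_eq_multichoose {A : ℝ} (hA : A ≠ 0) (B : ℝ) (m : ℕ) :
    affineProd A B m = (m.factorial : ℝ) * A ^ m * Ring.multichoose (1 + B / A) m := by
  induction m with
  | zero => simp [affineProd_zero]
  | succ m ih =>
    have h : A * (1 + B / A + m) = A * (m + 1) + B := by field_simp; ring
    rw [affineProd_succ, ih, Nat.factorial_succ, ← h]
    push_cast
    linear_combination (-(m.factorial : ℝ) * A ^ (m + 1)) *
      succ_mul_multichoose_succ (1 + B / A) m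

/-- The extra `B` is the factor `A j + B` at `j = 0`. It shifts the parameter from `1 + B / A` to `B
/ A` and the index to `m + 1`, which matches the terms of the exponential generating function. -/
theorem affineProd_mul_eq_multichoose {A : ℝ} (hA : A ≠ 0) (B : ℝ) (m : ℕ) :
    affineProd A B m * B =
      ((m + 1).factorial : ℝ) * A ^ (m + 1) * Ring.multichoose (B / A) (m + 1) := by
  induction m with
  | zero => simp [affineProd_zero, mul_div_cancel₀ _ hA]
  | succ m ih =>
    have h : A * (B / A + (m + 1)) = A * (m + 1) + B := by field_simp; ring
    have h1 := succ_mul_multichoose_succ (B / A) (m + 1)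
    rw [affineProd_succ, mul_right_comm, ih, Nat.factorial_succ (m + 1), ← h]
    push_cast at h1 ⊢
    linear_combination (-((m + 1).factorial : ℝ) * A ^ (m + 2)) * h1

theorem affineProd_eq_choose {A : ℝ} (hA : A ≠ 0) (B : ℝ) {k : ℕ} (hk : 1 ≤ k) :
    affineProd A B (k - 1) = ((k - 1).factorial : ℝ) * A ^ (k - 1) *
      Ring.choose ((k : ℝ) - 1 + B / A) (k - 1) := by
  rw [affineProd_eq_multichoose hA, Ring.multichoose_eq, Nat.cast_sub hk]
  congr 2
  push_cast
  ring

theorem affineProd_one_zero (m : ℕ) : affineProd 1 0 m = (m.factorial : ℝ) := by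
  rw [affineProd_eq_multichoose one_ne_zero]
  simp [Ring.multichoose_one]

theorem hasSum_of_eq {f g : ℕ → ℂ} {s : ℂ} (h : HasSum f s) (hfg : ∀ n, g n = f n) :
    HasSum g s := by
  rwa [funext hfg]

theorem hasSum_multichoose (a : ℂ) {x : ℂ} (hx : ‖x‖ < 1) :
    HasSum (fun n : ℕ => Ring.multichoose a n * x ^ n) (1 / (1 - x) ^ a) := by
  have h := (Complex.one_div_one_sub_cpow_hasFPowerSeriesOnBall_zero a).hasSum (y := x)
    (by simpa [enorm_eq_nnnorm, ← NNReal.coe_lt_coe] using hx)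
  simpa [FormalMultilinearSeries.ofScalars_apply_eq, Ring.multichoose_eq, mul_comm] using h

theorem ofReal_multichoose (a : ℝ) (n : ℕ) :
    ((Ring.multichoose a n : ℝ) : ℂ) = Ring.multichoose (a : ℂ) n :=
  Ring.map_multichoose (algebraMap ℝ ℂ) a n

/-- Up to the factor `1 / B` this is the binomial series at `A z` without its constant term. The
case `B = 0` is the logarithm and is treated separately. -/
theorem hasSum_affineProd {A B : ℝ} (hA : 0 < A) (hB : B ≠ 0) {z : ℂ} (hz : ‖z‖ < 1 / A) :
    HasSum (fun n : ℕ => (affineProd A B n : ℂ) * z ^ (n + 1) / ((n + 1).factorial : ℂ))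
      (1 / B * (1 / (1 - A * z) ^ ((B : ℂ) / A) - 1)) := by
  have hx : ‖(A : ℂ) * z‖ < 1 := by
    rw [lt_div_iff₀ hA] at hz
    simpa [abs_of_pos hA, mul_comm] using hz
  have h := ((hasSum_nat_add_iff' 1).2 (hasSum_multichoose ((B : ℂ) / A) hx)).mul_left (1 / (B : ℂ))
  simp only [sum_range_one, Ring.multichoose_zero_right, pow_zero, mul_one] at h
  refine hasSum_of_eq h fun n => ?_
  have hB' : (B : ℂ) ≠ 0 := by exact_mod_cast hB
  have hf : ((n + 1).factorial : ℂ) ≠ 0 := by exact_mod_cast (n + 1).factorial_ne_zero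
  have key : (affineProd A B n : ℂ) * B = ((n + 1).factorial : ℂ) * A ^ (n + 1) *
      Ring.multichoose ((B : ℂ) / A) (n + 1) := by
    rw [← Complex.ofReal_div, ← ofReal_multichoose]
    exact_mod_cast affineProd_mul_eq_multichoose hA.ne' B n
  rw [div_eq_iff hf]
  apply mul_right_cancel₀ hB'
  field_simp
  linear_combination z ^ (n + 1) * key

/-! ### The three families as affine cases -/

theorem recursiveRule_eq : recursiveRule = affineRule 1 0 := by
  funext c k n
  simp [recursiveRule, affineRule]

theorem aryRule_eq (d : ℕ) : aryRule d = affineRule ((d : ℝ) - 1) 1 := by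
  funext c k n
  simp only [aryRule, affineRule]
  congr 1
  ring

theorem portRule_eq (α : ℝ) : portRule α = affineRule (α + 1) (-1) := by
  funext c k n
  simp only [portRule, affineRule]
  congr 1
  ring

theorem recursive_affineWeights (b : ℕ) :
    AffineWeights b 1 0 (recursiveφ b) recursiveψ where
  pos n hn := by
    have : (0 : ℝ) < n := by exact_mod_cast hn
    simpa using this
  φ_nonneg k := by unfold recursiveφ; positivity
  φ_zero := by simp [recursiveφ, affineProd_one_zero]
  ψ_eq k _ _ := by simp [recursiveψ, affineProd_one_zero]
  φ_succ k := by
    rw [recursiveφ, recursiveφ, Nat.factorial_succ]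
    push_cast
    field_simp
    ring

theorem ary_affineWeights {b d : ℕ} (hb : 1 ≤ b) (hd : 2 ≤ d) :
    AffineWeights b ((d : ℝ) - 1) 1 (aryφ d b) (aryψ d) := by
  have hA : (0 : ℝ) < (d : ℝ) - 1 := by
    have : (2 : ℝ) ≤ d := by exact_mod_cast hd
    linarith
  have hpos : ∀ n : ℕ, 0 < ((d : ℝ) - 1) * n + 1 := fun n => by positivity
  have hφ : ∀ k, aryφ d b k =
      affineProd ((d : ℝ) - 1) 1 (b - 1) * ((b * (d - 1) + 1).choose k : ℝ) := fun k => by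
    rw [affineProd_eq_choose hA.ne' 1 hb, aryφ]
  refine ⟨fun n _ => hpos n, fun k => ?_, ?_, fun k hk _ => ?_, fun k => ?_⟩
  · rw [hφ]
    refine mul_nonneg (prod_nonneg fun j _ => ?_) (Nat.cast_nonneg _)
    exact_mod_cast (hpos (j + 1)).le
  · rw [hφ, Nat.choose_zero_right, Nat.cast_one, mul_one]
  · rw [affineProd_eq_choose hA.ne' 1 hk, aryψ]
  · rw [hφ, hφ]
    have hN : ((b * (d - 1) + 1 : ℕ) : ℝ) = ((d : ℝ) - 1) * b + 1 := by
      rw [Nat.cast_add, Nat.cast_mul, Nat.cast_sub (by omega)]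
      push_cast
      ring
    have hc : (((b * (d - 1) + 1).choose (k + 1) : ℕ) : ℝ) * ((k : ℝ) + 1) =
        ((b * (d - 1) + 1).choose k : ℝ) * (((d : ℝ) - 1) * b + 1 - k) := by
      rw [← hN]
      -- Beyond the top index both binomial coefficients vanish, so the possibly negative last
      -- factor does no harm.
      rcases le_or_gt k (b * (d - 1) + 1) with hk | hk
      · rw [← Nat.cast_sub hk]
        exact_mod_cast Nat.choose_succ_right_eq _ k
      · rw [Nat.choose_eq_zero_of_lt hk, Nat.choose_eq_zero_of_lt (by omega)]
        simp
    linear_combination affineProd ((d : ℝ) - 1) 1 (b - 1) * hc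

theorem portφ_eq {α : ℝ} (hα : 0 < α) {b : ℕ} (hb : 1 ≤ b) (k : ℕ) :
    portφ α b k = affineProd (α + 1) (-1) (b - 1) *
      Ring.multichoose ((α + 1) * b - 1) k := by
  rw [affineProd_eq_choose (by positivity) (-1) hb, portφ, Ring.multichoose_eq, neg_div,
    ← sub_eq_add_neg, show (α + 1) * (b : ℝ) - 2 + k = (α + 1) * b - 1 + k - 1 by ring]

theorem port_affineWeights {b : ℕ} (hb : 1 ≤ b) {α : ℝ} (hα : 0 < α) :
    AffineWeights b (α + 1) (-1) (portφ α b) (portψ α) := by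
  have hpos : ∀ n : ℕ, 1 ≤ n → 0 < (α + 1) * n + -1 := fun n hn => by
    have h1 : (1 : ℝ) ≤ n := by exact_mod_cast hn
    nlinarith
  have hsucc : ∀ k : ℕ, ((k : ℝ) + 1) * portφ α b (k + 1) =
      ((α + 1) * b + -1 * (1 - k)) * portφ α b k := fun k => by
    rw [portφ_eq hα hb, portφ_eq hα hb]
    linear_combination affineProd (α + 1) (-1) (b - 1) *
      succ_mul_multichoose_succ ((α + 1) * b - 1) k
  have hzero : portφ α b 0 = affineProd (α + 1) (-1) (b - 1) := by
    rw [portφ_eq hα hb, Ring.multichoose_zero_right, mul_one]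
  refine ⟨hpos, fun k => ?_, hzero, fun k hk _ => ?_, hsucc⟩
  -- Nonnegativity propagates along the recurrence, whose factor `(α + 1) b - 1 + k` is positive.
  · induction k with
    | zero =>
      rw [hzero]
      exact prod_nonneg fun j _ => by exact_mod_cast (hpos (j + 1) (by omega)).le
    | succ k ih =>
      have h1 : 0 ≤ ((k : ℝ) + 1) * portφ α b (k + 1) := by
        rw [hsucc]
        refine mul_nonneg ?_ ih
        have := hpos b hb
        have : (0 : ℝ) ≤ k := Nat.cast_nonneg k
        linarith
      exact nonneg_of_mul_nonneg_right h1 (by positivity)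
  · rw [affineProd_eq_choose (by positivity) (-1) hk, portψ, neg_div, ← sub_eq_add_neg]

/-! ### Closed forms and generating functions -/

namespace AffineWeights

variable {b : ℕ} {A B : ℝ} {φ ψ : ℕ → ℝ}

theorem total_eq_choose (h : AffineWeights b A B φ ψ) (hb : 1 ≤ b) (hA : A ≠ 0) {n : ℕ}
    (hn : 1 ≤ n) : total b φ ψ n = ((n - 1).factorial : ℝ) * A ^ (n - 1) *
      Ring.choose ((n : ℝ) - 1 + B / A) (n - 1) := by
  rw [← affineProd_eq_choose hA B hn, ← h.total_eq hb, Nat.sub_add_cancel hn]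

theorem hasEGF_total (h : AffineWeights b A B φ ψ) (hb : 1 ≤ b) (hA : 0 < A) (hB : B ≠ 0) {z : ℂ}
    (hz : ‖z‖ < 1 / A) :
    HasEGF (total b φ ψ) z (1 / B * (1 / (1 - A * z) ^ ((B : ℂ) / A) - 1)) := by
  simpa only [HasEGF, h.total_eq hb] using hasSum_affineProd hA hB hz

end AffineWeights

theorem hasGF_recursiveφ (b : ℕ) (t : ℂ) :
    HasGF (recursiveφ b) t (((b - 1).factorial : ℂ) * Complex.exp (b * t)) := by
  have h := (NormedSpace.expSeries_div_hasSum_exp ((b : ℂ) * t)).mul_left ((b - 1).factorial : ℂ)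
  rw [← Complex.exp_eq_exp_ℂ] at h
  unfold HasGF
  refine hasSum_of_eq h fun k => ?_
  simp only [recursiveφ]
  push_cast
  ring

theorem hasEGF_recursive {b : ℕ} (hb : 1 ≤ b) {z : ℂ} (hz : ‖z‖ < 1) :
    HasEGF (total b (recursiveφ b) recursiveψ) z (Complex.log (1 / (1 - z))) := by
  have hre : 0 < (1 - z).re := by
    have := (Complex.re_le_norm z).trans_lt hz
    simpa using this
  have harg : (1 - z).arg ≠ Real.pi :=
    (Complex.mem_slitPlane_iff_arg.1 (Or.inl hre)).1
  rw [one_div, Complex.log_inv _ harg]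
  -- The term of index `0` is `z ^ 0 / 0 = 0`, so dropping it leaves the sum unchanged.
  have h := (hasSum_nat_add_iff' 1).2 (Complex.hasSum_taylorSeries_neg_log hz)
  simp only [sum_range_one, pow_zero, Nat.cast_zero, div_zero, sub_zero] at h
  unfold HasEGF
  refine hasSum_of_eq h fun n => ?_
  have hf : (n.factorial : ℂ) ≠ 0 := by exact_mod_cast n.factorial_ne_zero
  rw [(recursive_affineWeights b).total_eq hb, affineProd_one_zero, Nat.factorial_succ]
  push_cast
  field_simp

theorem hasGF_aryφ (d b : ℕ) (t : ℂ) :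
    HasGF (aryφ d b) t ((((b - 1).factorial : ℝ) * ((d : ℝ) - 1) ^ (b - 1) *
      Ring.choose ((b : ℝ) - 1 + 1 / ((d : ℝ) - 1)) (b - 1) : ℝ) *
        (1 + t) ^ (b * (d - 1) + 1)) := by
  unfold HasGF
  have h : HasSum (fun k : ℕ => ((b * (d - 1) + 1).choose k : ℂ) * t ^ k)
      ((1 + t) ^ (b * (d - 1) + 1)) := by
    have hsum : (1 + t) ^ (b * (d - 1) + 1) = ∑ k ∈ range (b * (d - 1) + 1 + 1),
        ((b * (d - 1) + 1).choose k : ℂ) * t ^ k := by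
      rw [add_comm 1 t, add_pow]
      exact sum_congr rfl fun k _ => by rw [one_pow, mul_one, mul_comm]
    rw [hsum]
    refine hasSum_sum_of_ne_finset_zero fun k hk => ?_
    rw [Nat.choose_eq_zero_of_lt (by simpa [Nat.lt_succ_iff] using hk)]
    simp
  refine hasSum_of_eq (h.mul_left _) fun k => ?_
  simp only [aryφ]
  push_cast
  ring

theorem hasGF_portφ {α : ℝ} (hα : 0 < α) {b : ℕ} (hb : 1 ≤ b) {t : ℂ} (ht : ‖t‖ < 1) :
    HasGF (portφ α b) t ((((b - 1).factorial : ℝ) * (α + 1) ^ (b - 1) *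
      Ring.choose ((b : ℝ) - 1 - 1 / (α + 1)) (b - 1) : ℝ) /
        (1 - t) ^ (((α : ℂ) + 1) * b - 1)) := by
  have h := (hasSum_multichoose (((α : ℂ) + 1) * b - 1) ht).mul_left
    (affineProd (α + 1) (-1) (b - 1) : ℂ)
  have hc := affineProd_eq_choose (A := α + 1) (by positivity) (-1) hb
  rw [neg_div, ← sub_eq_add_neg] at hc
  rw [← hc, ← mul_one_div]
  unfold HasGF
  refine hasSum_of_eq h fun k => ?_
  rw [portφ_eq hα hb, Complex.ofReal_mul, ofReal_multichoose]
  push_cast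
  ring

end BucketIncreasing

theorem theorem1 (b : ℕ) (hb : 1 ≤ b) :
    -- bucket recursive trees
    (Realizes b recursiveRule (recursiveφ b) recursiveψ ∧
      (∀ t : ℂ, HasGF (recursiveφ b) t (((b - 1).factorial : ℂ) * Complex.exp (b * t))) ∧
      (∀ z : ℂ, ‖z‖ < 1 →
        HasEGF (total b (recursiveφ b) recursiveψ) z (Complex.log (1 / (1 - z)))) ∧
      (∀ n : ℕ, 1 ≤ n → total b (recursiveφ b) recursiveψ n = ((n - 1).factorial : ℝ))) ∧
    -- (b,d)-ary increasing trees
    (∀ d : ℕ, 2 ≤ d →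
      Realizes b (aryRule d) (aryφ d b) (aryψ d) ∧
      (∀ t : ℂ, HasGF (aryφ d b) t
        ((((b - 1).factorial : ℝ) * ((d : ℝ) - 1) ^ (b - 1) *
          Ring.choose ((b : ℝ) - 1 + 1 / ((d : ℝ) - 1)) (b - 1) : ℝ) *
            (1 + t) ^ (b * (d - 1) + 1))) ∧
      (∀ z : ℂ, ‖z‖ < 1 / ((d : ℝ) - 1) →
        HasEGF (total b (aryφ d b) (aryψ d)) z
          (1 / (1 - ((d : ℂ) - 1) * z) ^ (1 / ((d : ℂ) - 1)) - 1)) ∧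
      (∀ n : ℕ, 1 ≤ n → total b (aryφ d b) (aryψ d) n =
        ((n - 1).factorial : ℝ) * ((d : ℝ) - 1) ^ (n - 1) *
          Ring.choose ((n : ℝ) - 1 + 1 / ((d : ℝ) - 1)) (n - 1))) ∧
    -- (b,α)-plane oriented recursive trees
    (∀ α : ℝ, 0 < α →
      Realizes b (portRule α) (portφ α b) (portψ α) ∧
      (∀ t : ℂ, ‖t‖ < 1 → HasGF (portφ α b) t
        ((((b - 1).factorial : ℝ) * (α + 1) ^ (b - 1) *
          Ring.choose ((b : ℝ) - 1 - 1 / (α + 1)) (b - 1) : ℝ) /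
            (1 - t) ^ (((α : ℂ) + 1) * b - 1))) ∧
      (∀ z : ℂ, ‖z‖ < 1 / (α + 1) →
        HasEGF (total b (portφ α b) (portψ α)) z
          (1 - (1 - ((α : ℂ) + 1) * z) ^ (1 / ((α : ℂ) + 1)))) ∧
      (∀ n : ℕ, 1 ≤ n → total b (portφ α b) (portψ α) n =
        ((n - 1).factorial : ℝ) * (α + 1) ^ (n - 1) *
          Ring.choose ((n : ℝ) - 1 - 1 / (α + 1)) (n - 1))) := by
  refine ⟨⟨?_, hasGF_recursiveφ b, fun z hz => hasEGF_recursive hb hz, fun n hn => ?_⟩,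
    fun d hd => ?_, fun α hα => ?_⟩
  · rw [recursiveRule_eq]
    exact (recursive_affineWeights b).realizes hb
  · obtain ⟨m, rfl⟩ := Nat.exists_eq_add_of_le' hn
    rw [(recursive_affineWeights b).total_eq hb, affineProd_one_zero, Nat.add_sub_cancel]
  · have h := ary_affineWeights hb hd
    have hA : (0 : ℝ) < (d : ℝ) - 1 := by
      have : (2 : ℝ) ≤ d := by exact_mod_cast hd
      linarith
    refine ⟨?_, hasGF_aryφ d b, fun z hz => ?_, fun n hn => h.total_eq_choose hb hA.ne' hn⟩
    · rw [aryRule_eq]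
      exact h.realizes hb
    · have := h.hasEGF_total hb hA one_ne_zero hz
      push_cast at this
      rwa [div_one, one_mul] at this
  · have h := port_affineWeights hb hα
    have hA : 0 < α + 1 := by positivity
    refine ⟨?_, fun t ht => hasGF_portφ hα hb ht, fun z hz => ?_, fun n hn => ?_⟩
    · rw [portRule_eq]
      exact h.realizes hb
    · have := h.hasEGF_total hb hA (by norm_num) hz
      push_cast at this
      -- With `B = -1` the exponent `B / A` is negative, so the reciprocal power becomes a power
      -- with positive exponent; the factor `1 / B` reverses the sign.
      rw [neg_div, Complex.cpow_neg, one_div (_⁻¹), inv_inv] at this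
      convert this using 1
      ring
    · rw [h.total_eq_choose hb hA.ne' hn, neg_div, ← sub_eq_add_neg]
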